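/- Let $\mathcal P$ be a finite poset with $p$ elements, let $H(\mathcal P)$ be its Hasse diagram, and let $\mathcal X=(X_1,\dots,X_r)$ be a nice path decomposition of $H(\mathcal P)$ of width $k=\max_i|X_i|-1\ge 0$; that is, a path decomposition of the underlying undirected graph with $|X_1|=1$, $X_r=\varnothing$ and $|X_i\,\triangle\,X_{i+1}|=1$ for $1\le i<r$ (so necessarily $r=2p$). Then there is a stable matching (SM) instance $I$ with $n$ men, $n$ women and complete preference lists such that 1. $I$ realizes $\mathcal P$: the rotation poset of $I$ is isomorphic to $\mathcal P$; 2. $I\in\mathrm{range}(9(k+2))$: for every agent $a$, the largest and the smallest rank that $a$ receives in the preference lists of the agents of the opposite sex differ by at most $9(k+2)-1$; 3. $I$ has $2n=O((k+1)p)$ agents; 4. $I$ can be constructed in $O((k+1)^2p^2)$ time: there is one program for the word RAM with words of $O(\log p)$ bits (unit cost per elementary instruction) that, given $p$, a list of the edges of $H(\mathcal P)$ and a list of the bags $X_1,\dots,X_r$ (each bag as a list of its vertices, the vertices being numbered in any way), halts after $O((k+1)^2p^2)$ steps and outputs $n$ and all preference lists of such an $I$. All implied constants are absolute. (For $k\ge1$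 the bounds are $O(kp)$ agents and $O(k^2p^2)$ time.) -/

import Mathlib

/-! ### Stable matching instances with complete preference lists -/

/-- A stable matching instance with `n` men and `n` women and complete preference lists. Men and
women are both numbered by `Fin n`. `man m j` is the woman in position `j` (counted from `0`, best
first) of the list of the man `m`, and `woman w j` is the man in position `j` of the list of the
woman `w`. -/
structure SMInstance (n : ℕ) where
  man : Fin n → (Fin n ≃ Fin n)
  woman : Fin n → (Fin n ≃ Fin n)

namespace SMInstance

variable {n : ℕ} (I : SMInstance n)

/-- The rank (counted from `1`) that the man `m` gives to the woman `w`. -/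
def manRank (m w : Fin n) : ℕ := ((I.man m).symm w : ℕ) + 1

/-- The rank (counted from `1`) that the woman `w` gives to the man `m`. -/
def womanRank (w m : Fin n) : ℕ := ((I.woman w).symm m : ℕ) + 1

/-- maxrank minus minrank of a woman, over the lists of all men. -/
noncomputable def womanSpread (w : Fin n) : ℕ :=
  (Finset.univ.sup fun m => I.manRank m w) - (⨅ m, I.manRank m w)

/-- maxrank minus minrank of a man, over the lists of all women. -/
noncomputable def manSpread (m : Fin n) : ℕ :=
  (Finset.univ.sup fun w => I.womanRank w m) - (⨅ w, I.womanRank w m)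

/-- The range of the instance: the largest value of `maxrank - minrank` over all agents,
plus one. -/
noncomputable def range : ℕ :=
  max (Finset.univ.sup I.womanSpread) (Finset.univ.sup I.manSpread) + 1

/-- `I` has `k`-range preferences. -/
def InRange (k : ℕ) : Prop := 0 < n ∧ I.range ≤ k

/-- A matching, as a bijection from the men to the women, is stable if it has no blocking pair. -/
def Stable (μ : Fin n ≃ Fin n) : Prop :=
  ¬ ∃ m w, I.manRank m w < I.manRank m (μ m) ∧ I.womanRank w m < I.womanRank w (μ.symm w)

/-- The man-optimal stable matching: every man has his best stable partner. -/
def ManOptimal (μ : Fin n ≃ Fin n) : Prop :=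
  I.Stable μ ∧ ∀ μ', I.Stable μ' → ∀ m, I.manRank m (μ m) ≤ I.manRank m (μ' m)

/-- `w` is the first woman after `μ m` on the list of `m` who prefers `m` to her partner
in `μ`. -/
def NextWoman (μ : Fin n ≃ Fin n) (m w : Fin n) : Prop :=
  I.manRank m (μ m) < I.manRank m w ∧ I.womanRank w m < I.womanRank w (μ.symm w) ∧
    ∀ w', I.manRank m (μ m) < I.manRank m w' → I.manRank m w' < I.manRank m w →
      ¬ I.womanRank w' m < I.womanRank w' (μ.symm w')

/-- The circular list `ρ` of pairs (man, woman) is a rotation exposed in the stable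
matching `μ`. -/
def Exposed (μ : Fin n ≃ Fin n) (ρ : Cycle (Fin n × Fin n)) : Prop :=
  I.Stable μ ∧ ρ ≠ Cycle.nil ∧ ρ.Nodup ∧ (∀ a ∈ ρ, μ a.1 = a.2) ∧
    ρ.Chain fun a b => I.NextWoman μ a.1 b.2

/-- The set `R(I)` of all rotations exposed in some stable matching. -/
def rotations : Set (Cycle (Fin n × Fin n)) := {ρ | ∃ μ, I.Exposed μ ρ}

/-- `b` comes directly after `a` in the circular list `ρ`. -/
def Consecutive (ρ : Cycle (Fin n × Fin n)) (a b : Fin n × Fin n) : Prop :=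
  ∃ (h : ρ.Nodup) (ha : a ∈ ρ), ρ.next h a ha = b

/-- `μ'` is obtained from `μ` by eliminating `ρ`: the pairs `(mᵢ, wᵢ)` of `ρ` are replaced by the
pairs `(mᵢ, wᵢ₊₁)`. -/
def Elimination (μ : Fin n ≃ Fin n) (ρ : Cycle (Fin n × Fin n)) (μ' : Fin n ≃ Fin n) : Prop :=
  {x : Fin n × Fin n | μ' x.1 = x.2} =
    ({x | μ x.1 = x.2} \ {x | x ∈ ρ}) ∪ {x | ∃ a b, Consecutive ρ a b ∧ x = (a.1, b.2)}

/-- `EliminationSeq L μ`: starting from the man-optimal stable matching, successively eliminating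
the exposed rotations in `L` (latest first) leads to `μ`. -/
inductive EliminationSeq : List (Cycle (Fin n × Fin n)) → (Fin n ≃ Fin n) → Prop
  | start (μ : Fin n ≃ Fin n) (h : I.ManOptimal μ) : EliminationSeq [] μ
  | step (L : List (Cycle (Fin n × Fin n))) (ρ : Cycle (Fin n × Fin n)) (μ μ' : Fin n ≃ Fin n)
      (h : EliminationSeq L μ) (hρ : I.Exposed μ ρ) (hμ : Elimination μ ρ μ') :
      EliminationSeq (ρ :: L) μ'

/-- The set `R_μ` of the rotations that are eliminated on the way from the man-optimal stable
matching to `μ`. -/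
def eliminated (μ : Fin n ≃ Fin n) : Set (Cycle (Fin n × Fin n)) :=
  {ρ | ∃ L, I.EliminationSeq L μ ∧ ρ ∈ L}

/-- `ρ ≺ ρ'`: the rotation `ρ` was eliminated in every stable matching in which `ρ'` is
exposed. -/
def Precedes (ρ ρ' : I.rotations) : Prop :=
  ∀ μ, I.Exposed μ (ρ' : Cycle (Fin n × Fin n)) →
    (ρ : Cycle (Fin n × Fin n)) ∈ I.eliminated μ

/-- `I` realizes the poset `V`: the rotation poset of `I` is isomorphic to `V`. -/
def Realizes (V : Type*) [PartialOrder V] : Prop :=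
  Nonempty ((fun x y : V => x < y) ≃r I.Precedes)

end SMInstance

/-! ### Path decompositions -/

section PathDecomposition

variable {V : Type*} {r : ℕ}

/-- `X 0, …, X (r - 1)` is a path decomposition of the graph `G`. -/
def IsPathDecomposition (G : SimpleGraph V) (X : Fin r → Finset V) : Prop :=
  (∀ v, ∃ i, v ∈ X i) ∧ (∀ u v, G.Adj u v → ∃ i, u ∈ X i ∧ v ∈ X i) ∧
    ∀ i j l, i ≤ j → j ≤ l → ∀ v, v ∈ X i → v ∈ X l → v ∈ X j

/-- A nice path decomposition: the first bag has one element, the last bag is empty, and consecutive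
bags differ in exactly one element. -/
def IsNicePathDecomposition [DecidableEq V] (G : SimpleGraph V) (X : Fin r → Finset V) : Prop :=
  IsPathDecomposition G X ∧ 0 < r ∧ (∀ i : Fin r, (i : ℕ) = 0 → (X i).card = 1) ∧
    (∀ i : Fin r, (i : ℕ) + 1 = r → (X i).card = 0) ∧
    ∀ i j : Fin r, (i : ℕ) + 1 = j → (symmDiff (X i) (X j)).card = 1

/-- The width of a path decomposition: the largest size of a bag, minus one. -/
def pathDecompositionWidth (X : Fin r → Finset V) : ℕ :=
  (Finset.univ.sup fun i => (X i).card) - 1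

end PathDecomposition

/-! ### Word RAM programs

A structured random access machine. The memory consists of registers and of arrays, both zero unless
something was written to them; every cell holds a natural number. A program names finitely many
registers and arrays. -/

namespace RAM

/-- A memory state: `reg x` is the content of register `x`, and `arr a i` is the content of cell `i`
of array `a`. -/
structure State where
  reg : ℕ → ℕ
  arr : ℕ → ℕ → ℕ

/-- Write `v` to register `x`. -/
def State.setReg (s : State) (x v : ℕ) : State := { s with reg := Function.update s.reg x v }

/-- Write `v` to cell `i` of array `a`. -/
def State.setArr (s : State) (a i v : ℕ) : State :=
  { s with arr := Function.update s.arr a (Function.update (s.arr a) i v) }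

/-- Arithmetic operations; `sub` is truncated subtraction. -/
inductive Op
  | add
  | sub
  | mul

/-- The value of an arithmetic operation. -/
def Op.eval : Op → ℕ → ℕ → ℕ
  | .add, a, b => a + b
  | .sub, a, b => a - b
  | .mul, a, b => a * b

/-- Programs. -/
inductive Prog
  | skip
  /-- register `x` := the constant `v` -/
  | const (x v : ℕ)
  /-- register `x` := register `y` -/
  | copy (x y : ℕ)
  /-- register `x` := register `y` ∘ register `z` -/
  | arith (o : Op) (x y z : ℕ)
  /-- register `x` := the cell of array `a` whose index is in register `y` -/
  | load (x a y : ℕ)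
  /-- the cell of array `a` whose index is in register `x` := register `y` -/
  | store (a x y : ℕ)
  | seq (c d : Prog)
  /-- if register `x` < register `y`, run `c`, else run `d` -/
  | ite (x y : ℕ) (c d : Prog)
  /-- while register `x` < register `y`, run `c` -/
  | loop (x y : ℕ) (c : Prog)

/-- `Exec B c s s' t`: on a machine whose words hold the numbers `0, …, B`, the program `c` started
in the state `s` halts in the state `s'` after exactly `t` elementary steps. Every elementary
instruction and every evaluation of a test is one step. A computation that produces a number larger
than `B` has no execution. -/
inductive Exec (B : ℕ) : Prog → State → State → ℕ → Prop
  | skip (s : State) : Exec B .skip s s 1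
  | const (x v : ℕ) (s : State) (h : v ≤ B) : Exec B (.const x v) s (s.setReg x v) 1
  | copy (x y : ℕ) (s : State) : Exec B (.copy x y) s (s.setReg x (s.reg y)) 1
  | arith (o : Op) (x y z : ℕ) (s : State) (h : o.eval (s.reg y) (s.reg z) ≤ B) :
      Exec B (.arith o x y z) s (s.setReg x (o.eval (s.reg y) (s.reg z))) 1
  | load (x a y : ℕ) (s : State) : Exec B (.load x a y) s (s.setReg x (s.arr a (s.reg y))) 1
  | store (a x y : ℕ) (s : State) :
      Exec B (.store a x y) s (s.setArr a (s.reg x) (s.reg y)) 1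
  | seq (c d : Prog) (s s' s'' : State) (t t' : ℕ) (hc : Exec B c s s' t)
      (hd : Exec B d s' s'' t') : Exec B (.seq c d) s s'' (t + t')
  | ite_true (x y : ℕ) (c d : Prog) (s s' : State) (t : ℕ) (h : s.reg x < s.reg y)
      (hc : Exec B c s s' t) : Exec B (.ite x y c d) s s' (1 + t)
  | ite_false (x y : ℕ) (c d : Prog) (s s' : State) (t : ℕ) (h : ¬ s.reg x < s.reg y)
      (hd : Exec B d s s' t) : Exec B (.ite x y c d) s s' (1 + t)
  | loop_true (x y : ℕ) (c : Prog) (s s' s'' : State) (t t' : ℕ) (h : s.reg x < s.reg y)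
      (hc : Exec B c s s' t) (hl : Exec B (.loop x y c) s' s'' t') :
      Exec B (.loop x y c) s s'' (1 + t + t')
  | loop_false (x y : ℕ) (c : Prog) (s : State) (h : ¬ s.reg x < s.reg y) :
      Exec B (.loop x y c) s s 1

/-- The initial state for an input that consists of a number `p` of vertices, a list of directed
edges, and a list of bags, the vertices being `0, …, p - 1`. Registers `0`, `1`, `2` hold the numbers
of vertices, edges and bags; arrays `0` and `1` hold the first and the second endpoints of the
edges; array `3` holds the bags, one after the other, and bag `i` occupies the cells from
`arr 2 i` up to, but not including, `arr 2 (i + 1)`. -/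
def inputState (p : ℕ) (edges : List (ℕ × ℕ)) (bags : List (List ℕ)) : State where
  reg
    | 0 => p
    | 1 => edges.length
    | 2 => bags.length
    | _ => 0
  arr
    | 0, i => (edges.map Prod.fst).getD i 0
    | 1, i => (edges.map Prod.snd).getD i 0
    | 2, i => if i ≤ bags.length then ((bags.map List.length).take i).sum else 0
    | 3, i => bags.flatten.getD i 0
    | _, _ => 0

/-- The state `s` holds the instance `I` of size `n`: register `0` holds `n`, and arrays `4` and `5`
hold the preference lists of the men and of the women, list after list. -/
def State.Holds (s : State) {n : ℕ} (I : SMInstance n) : Prop :=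
  s.reg 0 = n ∧ (∀ m j : Fin n, s.arr 4 (m * n + j) = I.man m j) ∧
    ∀ w j : Fin n, s.arr 5 (w * n + j) = I.woman w j

end RAM

/-! ### Cyclic lists -/

namespace Cycle

/-! Number the positions of the concatenated bags by `q < N`, and let position `q` carry two agents,
`2q` and `2q+1`, on each side, so `n = 2N`. All occurrences of a vertex `v` are folded into one
cycle of a permutation `σ`, which climbs along the even agents and returns along the odd ones. As
the bags containing `v` form an interval, `σ` moves an agent by at most one bag. Having two agents
per position rules out fixed points. `RotationFrame` records exactly what is needed of this data.

Woman `x` is the first partner of man `x`, and woman `σ x` his second. Between the two he ranks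
those women `w` of his own bag whose vertex is covered by his; such a `w` ranks him between her
second partner `σ⁻¹ w` and her first partner `w`. Turning the cycles in a set `D` therefore produces
a blocking pair exactly when `D` misses something covered by one of its elements. Every covering
pair meets in a bag, so the stable matchings are those with `D` a lower set (`matching_stable`,
`eq_matching_of_stable`). An exposed rotation turns the cycle of a minimal element outside `D`
(`exposed_rot`, `eq_rot_of_exposed`), and the rotation order is that of the poset (`precedes_iff`).

For the range, each list keeps the global numbering except near its owner: agents at least two bags
earlier come first, all remaining ordinary agents last. Placing early agents first is harmless,
since they rank the owner behind both of their own relevant partners. Only the owner's bag and the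
two partners are displaced, so every rank stays within O(k) of the agent's number (`rank_bounds`).

For the size, each step of a nice decomposition introduces or removes a vertex, and each vertex has
each event at most once; hence there are O(p) bags and N = O((k+1)p). The program builds the fold
incrementally, then writes each list by scanning all agents once for each of five sections, which
costs O(n²) = O((k+1)²p²) in total (`mainCode_runs`). -/

theorem chain_iff_forall_next {α : Type*} [DecidableEq α] {r : α → α → Prop} (s : Cycle α)
    (h : s.Nodup) : s.Chain r ↔ ∀ a (ha : a ∈ s), r a (s.next h a ha) := by
  induction s using Quotient.inductionOn' with | _ l
  rcases l with _ | ⟨a, l⟩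
  · exact ⟨fun _ a ha => absurd ha (List.not_mem_nil), fun _ => Cycle.Chain.nil r⟩
  change (Cycle.Chain r ((a :: l : List α) : Cycle α)) ↔ ∀ b (hb : b ∈ (a :: l)), r b (List.next (a :: l) b hb)
  rw [chain_coe_cons, List.isChain_iff_getElem]
  have hl : (a :: l).Nodup := h
  constructor
  · intro H b hb
    obtain ⟨i, hi, rfl⟩ := List.getElem_of_mem hb
    rw [List.next_getElem _ hl]
    have := H i (by simpa using hi)
    simp only [← List.cons_append] at this
    rw [List.getElem_append_left hi] at this
    rcases Nat.lt_or_ge (i + 1) (a :: l).length with h1 | h1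
    · rw [List.getElem_append_left h1] at this
      simpa only [Nat.mod_eq_of_lt h1] using this
    · have h2 : i + 1 = (a :: l).length := by omega
      rw [List.getElem_append_right h1] at this
      simpa [h2] using this
  · intro H i hi
    have hi' : i < (a :: l).length := by simpa using hi
    have := H _ (List.getElem_mem hi')
    rw [List.next_getElem _ hl] at this
    simp only [← List.cons_append]
    rw [List.getElem_append_left hi']
    rcases Nat.lt_or_ge (i + 1) (a :: l).length with h1 | h1
    · rw [List.getElem_append_left h1]
      simpa only [Nat.mod_eq_of_lt h1] using this
    · have h2 : i + 1 = (a :: l).length := by omega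
      rw [List.getElem_append_right h1]
      simpa [h2] using this

/-- The cycle can be recovered from its permutation `formPerm`. Nontriviality is needed because all
cycles with at most one element induce the identity. -/
theorem eq_of_mem_iff_of_next_eq {α : Type*} [DecidableEq α] {s t : Cycle α} (hs : s.Nodup)
    (ht : t.Nodup) (hn : s.Nontrivial) (h : ∀ a, a ∈ s ↔ a ∈ t)
    (hnext : ∀ a (ha : a ∈ s) (hb : a ∈ t), s.next hs a ha = t.next ht a hb) : s = t := by
  have key : s.formPerm hs = t.formPerm ht := by
    ext a
    by_cases ha : a ∈ s
    · rw [formPerm_apply_mem_eq_next _ _ _ ha, formPerm_apply_mem_eq_next _ _ _ ((h a).1 ha)]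
      exact hnext a ha _
    · rw [formPerm_eq_self_of_notMem _ _ _ ha,
        formPerm_eq_self_of_notMem _ _ _ (fun hb => ha ((h a).2 hb))]
  rcases formPerm_eq_formPerm_iff.1 key with h1 | h1
  · exact h1
  · exact absurd h1.1 (hs.nontrivial_iff.1 hn)

end Cycle

/-! ### Instances whose stable matchings are the lower sets of a poset -/

namespace SMInstance

variable {n : ℕ} (I : SMInstance n)

theorem manRank_injective (m : Fin n) : Function.Injective (I.manRank m) := by
  intro a b h
  simp only [manRank, add_left_inj, Fin.val_inj] at h
  exact (I.man m).symm.injective h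

theorem womanRank_injective (w : Fin n) : Function.Injective (I.womanRank w) := by
  intro a b h
  simp only [womanRank, add_left_inj, Fin.val_inj] at h
  exact (I.woman w).symm.injective h

theorem Elimination.unique {μ μ₁ μ₂ : Fin n ≃ Fin n} {ρ : Cycle (Fin n × Fin n)}
    (h₁ : Elimination μ ρ μ₁) (h₂ : Elimination μ ρ μ₂) : μ₁ = μ₂ := by
  have h := h₁.trans h₂.symm
  ext m
  have : (m, μ₁ m) ∈ {x : Fin n × Fin n | μ₂ x.1 = x.2} := by rw [← h]; rfl
  exact congrArg Fin.val this.symm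

end SMInstance

/-- A permutation of `n` agents whose cycles are indexed by the elements of a poset `V` through
`own`, together with a division of the agents into groups, such that the permutation moves every
agent by at most one group and every covering pair meets in a group. -/
structure RotationFrame (V : Type*) [PartialOrder V] (n : ℕ) where
  own : Fin n → V
  bg : Fin n → ℕ
  σ : Equiv.Perm (Fin n)
  bg_mono : Monotone bg
  bg_σ_le : ∀ x, bg (σ x) ≤ bg x + 1
  le_bg_σ : ∀ x, bg x ≤ bg (σ x) + 1
  own_σ : ∀ x, own (σ x) = own x
  sameCycle : ∀ x y, own x = own y → σ.SameCycle x y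
  own_surjective : Function.Surjective own
  σ_ne : ∀ x, σ x ≠ x
  exists_of_covBy : ∀ u v : V, u ⋖ v → ∃ x y, bg x = bg y ∧ own x = u ∧ own y = v

namespace RotationFrame

variable {V : Type*} [PartialOrder V] {n : ℕ} (R : RotationFrame V n)

/-- The woman `w` blocks the way of the man `m`. -/
def Blocks (m w : Fin n) : Prop := R.bg w = R.bg m ∧ R.own w ⋖ R.own m

/-- The man `m` has to deal with the woman `w`. -/
def Special (m w : Fin n) : Prop := w = m ∨ w = R.σ m ∨ R.Blocks m w

/-- The preferences of the instance `I` are those that the frame prescribes. -/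
structure Fits (I : SMInstance n) : Prop where
  man_self : ∀ m, I.manRank m m < I.manRank m (R.σ m)
  man_blocks : ∀ m w, R.Blocks m w →
    I.manRank m m < I.manRank m w ∧ I.manRank m w < I.manRank m (R.σ m)
  man_other : ∀ m w, ¬ R.Special m w →
    (R.bg w + 1 < R.bg m ∧ I.manRank m w < I.manRank m m) ∨
      (¬ R.bg w + 1 < R.bg m ∧ I.manRank m (R.σ m) < I.manRank m w)
  woman_self : ∀ w, I.womanRank w (R.σ.symm w) < I.womanRank w w
  woman_blocks : ∀ m w, R.Blocks m w →
    I.womanRank w (R.σ.symm w) < I.womanRank w m ∧ I.womanRank w m < I.womanRank w w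
  woman_other : ∀ m w, ¬ R.Special m w →
    (R.bg m + 1 < R.bg w ∧ I.womanRank w m < I.womanRank w (R.σ.symm w)) ∨
      (¬ R.bg m + 1 < R.bg w ∧ I.womanRank w w < I.womanRank w m)

theorem own_symm (x : Fin n) : R.own (R.σ.symm x) = R.own x := by
  rw [← R.own_σ, Equiv.apply_symm_apply]

open Classical in
/-- The matching obtained by turning the cycles in `D`. -/
noncomputable def matching (D : Set V) : Fin n ≃ Fin n where
  toFun x := if R.own x ∈ D then R.σ x else x
  invFun x := if R.own x ∈ D then R.σ.symm x else x
  left_inv x := by by_cases h : R.own x ∈ D <;> simp [h, R.own_σ]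
  right_inv x := by by_cases h : R.own x ∈ D <;> simp [h, R.own_symm]

variable {R} {I : SMInstance n} {D : Set V}

/-! ### Matchings obtained by turning cycles -/

theorem matching_of_mem {x : Fin n} (h : R.own x ∈ D) : R.matching D x = R.σ x := by
  simp [matching, h]

theorem matching_of_notMem {x : Fin n} (h : R.own x ∉ D) : R.matching D x = x := by
  simp [matching, h]

theorem matching_symm_of_mem {x : Fin n} (h : R.own x ∈ D) :
    (R.matching D).symm x = R.σ.symm x := by
  rw [Equiv.symm_apply_eq, matching_of_mem (by rwa [R.own_symm]), Equiv.apply_symm_apply]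

theorem matching_symm_of_notMem {x : Fin n} (h : R.own x ∉ D) : (R.matching D).symm x = x := by
  rw [Equiv.symm_apply_eq, matching_of_notMem h]

theorem matching_injective : Function.Injective R.matching := by
  intro D D' h
  ext v
  obtain ⟨x, rfl⟩ := R.own_surjective v
  have hx : R.matching D x = R.matching D' x := by rw [h]
  have hne := R.σ_ne x
  by_cases h1 : R.own x ∈ D <;> by_cases h2 : R.own x ∈ D'
  · exact iff_of_true h1 h2
  · exact absurd (by rwa [matching_of_mem h1, matching_of_notMem h2] at hx) hne
  · exact absurd (by rwa [matching_of_notMem h1, matching_of_mem h2, eq_comm] at hx) hne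
  · exact iff_of_false h1 h2

theorem own_matching (x : Fin n) : R.own (R.matching D x) = R.own x := by
  by_cases h : R.own x ∈ D
  · rw [matching_of_mem h, R.own_σ]
  · rw [matching_of_notMem h]

/-- Everybody holds a first or second partner, so a non-special pair cannot block: at least one side
ranks the other behind both. A blocker pair would need the man's cycle turned and the woman's not,
which a lower set forbids. -/
theorem matching_stable (hF : R.Fits I) (hD : IsLowerSet D) : I.Stable (R.matching D) := by
  rintro ⟨m, w, h1, h2⟩
  have hm1 := hF.man_self m
  have hw1 := hF.woman_self w
  by_cases hs : R.Special m w
  · rcases hs with rfl | rfl | hs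
    · by_cases h : R.own w ∈ D
      · rw [matching_symm_of_mem h] at h2; omega
      · rw [matching_of_notMem h] at h1; omega
    · by_cases h : R.own m ∈ D
      · rw [matching_of_mem h] at h1; omega
      · rw [matching_of_notMem h] at h1; omega
    · have hm2 := hF.man_blocks m w hs
      have hw2 := hF.woman_blocks m w hs
      by_cases h : R.own m ∈ D
      · rw [matching_symm_of_mem (hD hs.2.le h)] at h2; omega
      · rw [matching_of_notMem h] at h1; omega
  · have h3 := hF.man_other m w hs
    have h4 := hF.woman_other m w hs
    by_cases h : R.own m ∈ D <;> by_cases h' : R.own w ∈ D <;>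
    simp only [h, h', matching_of_mem, matching_of_notMem, not_false_eq_true,
      matching_symm_of_mem, matching_symm_of_notMem] at h1 h2 <;> omega

/-! ### Classification of the stable matchings -/

/-- A man doing better than his first partner would hold a woman `w` at least two groups earlier,
who ranks him behind man `w`. By induction on the group, man `w` does not do better than woman `w`,
so the pair `(w, w)` blocks. -/
theorem man_optimal (hF : R.Fits I) {ν : Fin n ≃ Fin n} (hν : I.Stable ν) (m : Fin n) :
    I.manRank m m ≤ I.manRank m (ν m) := by
  induction hb : R.bg m using Nat.strong_induction_on generalizing m with | _ b IH
  subst hb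
  by_contra! hlt
  set w := ν m with hw
  have hm1 := hF.man_self m
  have hs : ¬ R.Special m w := by
    rintro (h | h | h)
    · rw [h] at hlt; omega
    · rw [h] at hlt; omega
    · have := hF.man_blocks m w h; omega
  have h3 := hF.man_other m w hs
  have h4 := hF.woman_other m w hs
  have IH' := IH (R.bg w) (by omega) w rfl
  have hne : ν w ≠ w := by
    intro h
    have : m = w := ν.injective (by rw [h])
    rw [← this] at h3; omega
  have hne' : I.manRank w w ≠ I.manRank w (ν w) := fun h => hne (I.manRank_injective w h).symm
  refine hν ⟨w, w, by omega, ?_⟩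
  have : ν.symm w = m := by simp [hw]
  rw [this]; omega

/-- The mirror argument: a woman doing better than `σ⁻¹ w` would hold a man `m` at least two groups
earlier, who ranks her behind `σ m`. Woman `σ m` lies at most one group after `m`, so induction
applies to her and `(m, σ m)` blocks. -/
theorem woman_optimal (hF : R.Fits I) {ν : Fin n ≃ Fin n} (hν : I.Stable ν) (w : Fin n) :
    I.womanRank w (R.σ.symm w) ≤ I.womanRank w (ν.symm w) := by
  induction hb : R.bg w using Nat.strong_induction_on generalizing w with | _ b IH
  subst hb
  by_contra! hlt
  set m := ν.symm w with hm
  have hw1 := hF.woman_self w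
  have hs : ¬ R.Special m w := by
    rintro (h | h | h)
    · rw [← h] at hlt; omega
    · rw [h, Equiv.symm_apply_apply, ← h] at hlt; omega
    · have := hF.woman_blocks m w h; omega
  have h3 := hF.man_other m w hs
  have h4 := hF.woman_other m w hs
  have h5 := R.bg_σ_le m
  have IH' := IH (R.bg (R.σ m)) (by omega) (R.σ m) rfl
  rw [Equiv.symm_apply_apply] at IH'
  have hνm : ν m = w := by simp [hm]
  have hne : ν.symm (R.σ m) ≠ m := by
    intro h
    rw [Equiv.symm_apply_eq, hνm] at h
    rw [h] at h5; omega
  have hne' : I.womanRank (R.σ m) m ≠ I.womanRank (R.σ m) (ν.symm (R.σ m)) := fun h =>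
    hne (I.womanRank_injective _ h).symm
  refine hν ⟨m, R.σ m, by rw [hνm]; omega, by omega⟩

/-- By `man_optimal`, a non-special partner can only lie behind `σ m` on the man's list. By
`woman_optimal`, woman `σ m` can get nobody better than `m`, so the two would block. -/
theorem special_of_stable (hF : R.Fits I) {ν : Fin n ≃ Fin n} (hν : I.Stable ν) (m : Fin n) :
    R.Special m (ν m) := by
  by_contra hs
  have h3 := hF.man_other m _ hs
  have h1 := man_optimal hF hν m
  have h2 := woman_optimal hF hν (R.σ m)
  rw [Equiv.symm_apply_apply] at h2
  have hne : ν.symm (R.σ m) ≠ m := by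
    intro h
    rw [Equiv.symm_apply_eq] at h
    exact hs (Or.inr (Or.inl h.symm))
  have hne' : I.womanRank (R.σ m) m ≠ I.womanRank (R.σ m) (ν.symm (R.σ m)) := fun h =>
    hne (I.womanRank_injective _ h).symm
  exact hν ⟨m, R.σ m, by omega, by omega⟩

/-- A property that spreads backwards along the permutation holds on a whole cycle. -/
theorem forall_of_own_eq {P : Fin n → Prop} {y : Fin n}
    (hP : ∀ x, R.own x = R.own y → P x → P (R.σ.symm x)) (hy : P y) (x : Fin n)
    (hx : R.own x = R.own y) : P x := by
  obtain ⟨i, rfl⟩ := (Equiv.Perm.sameCycle_inv.2 (R.sameCycle y x hx.symm)).exists_nat_pow_eq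
  clear hx
  suffices h : R.own ((R.σ⁻¹ ^ i) y) = R.own y ∧ P ((R.σ⁻¹ ^ i) y) from h.2
  induction i with
  | zero => exact ⟨rfl, hy⟩
  | succ i IH =>
    rw [pow_succ', Equiv.Perm.mul_apply]
    exact ⟨(R.own_symm _).trans IH.1, hP _ IH.1 IH.2⟩

/-- If all men of a cycle have their first or second partner, and one of them his first, then all
of them have their first partner. -/
theorem eq_self_of_cycle {ν : Fin n ≃ Fin n} {y : Fin n}
    (h : ∀ x, R.own x = R.own y → ν x = x ∨ ν x = R.σ x) (hy : ν y = y) (x : Fin n)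
    (hx : R.own x = R.own y) : ν x = x := by
  refine forall_of_own_eq (P := fun x => ν x = x) ?_ hy x hx
  intro z hz hνz
  -- Woman `z` is already taken by man `z`, so man `σ⁻¹ z` cannot have his second partner.
  refine (h (R.σ.symm z) (by rw [R.own_symm, hz])).resolve_right fun h' => ?_
  rw [Equiv.apply_symm_apply] at h'
  have h2 := ν.injective (h'.trans hνz.symm)
  rw [Equiv.symm_apply_eq] at h2
  exact R.σ_ne z h2.symm

/-- It remains to exclude a blocker `w` as partner. Her vertex is smaller, so by induction her whole
cycle uses first or second partners. Since `w` is occupied by `m`, man `σ⁻¹ w` must keep his first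
partner; then so does the whole cycle, and `w` belongs to man `w`. -/
theorem eq_or_eq_of_stable [Finite V] (hF : R.Fits I) {ν : Fin n ≃ Fin n} (hν : I.Stable ν)
    (m : Fin n) : ν m = m ∨ ν m = R.σ m := by
  induction hv : R.own m using WellFoundedLT.induction generalizing m with | _ v IH
  subst hv
  rcases special_of_stable hF hν m with h | h | h
  · exact Or.inl h
  · exact Or.inr h
  exfalso
  set w := ν m with hw
  have hlt := h.2.lt
  have hfib : ∀ x, R.own x = R.own w → ν x = x ∨ ν x = R.σ x := fun x hx =>
    IH (R.own w) hlt x hx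
  have h1 : ν (R.σ.symm w) = R.σ.symm w := by
    refine (hfib _ (R.own_symm w)).resolve_right fun h' => ?_
    rw [Equiv.apply_symm_apply, hw] at h'
    have := ν.injective h'
    rw [← this, R.own_symm] at hlt
    exact lt_irrefl _ hlt
  have h2 := eq_self_of_cycle (y := R.σ.symm w) (by simpa [R.own_symm] using hfib) h1 w
    (R.own_symm w).symm
  have h3 : w = m := ν.injective h2
  rw [h3] at hlt
  exact lt_irrefl _ hlt

theorem isLowerSet_of_covBy [Finite V] (h : ∀ u v : V, u ⋖ v → v ∈ D → u ∈ D) :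
    IsLowerSet D := by
  intro v u huv hv
  induction v using WellFoundedLT.induction with | _ v IH
  rcases huv.eq_or_lt with rfl | hlt
  · exact hv
  · obtain ⟨x, hx, hxv⟩ := exists_le_covBy_of_lt hlt
    exact IH x hxv.lt hx (h x v hxv hv)

theorem eq_matching_of_stable [Finite V] (hF : R.Fits I) {ν : Fin n ≃ Fin n} (hν : I.Stable ν) :
    ∃ D, IsLowerSet D ∧ ν = R.matching D := by
  have h := eq_or_eq_of_stable hF hν
  refine ⟨{v | ∀ x, R.own x = v → ν x = R.σ x}, isLowerSet_of_covBy ?_, ?_⟩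
  · intro u v huv hv x hx
    obtain ⟨a, b, hab, rfl, rfl⟩ := R.exists_of_covBy u v huv
    refine (h x).resolve_left fun hx' => ?_
    have ha : ν a = a := eq_self_of_cycle (fun x _ => h x) hx' a hx.symm
    -- If the cycle of `v` were turned and that of `u` not, the agents `b` and `a` meeting in a
    -- common group would form a blocking pair.
    have hB : R.Blocks b a := ⟨hab, huv⟩
    refine hν ⟨b, a, ?_, ?_⟩
    · rw [hv b rfl]; exact (hF.man_blocks b a hB).2
    · rw [← Equiv.eq_symm_apply] at ha
      rw [← ha]; exact (hF.woman_blocks b a hB).2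
  · ext x
    congr 1
    by_cases hx : R.own x ∈ {v | ∀ x, R.own x = v → ν x = R.σ x}
    · rw [matching_of_mem hx]; exact hx x rfl
    · rw [matching_of_notMem hx]
      simp only [Set.mem_ofPred_eq, not_forall] at hx
      obtain ⟨y, hy, hνy⟩ := hx
      exact eq_self_of_cycle (fun x _ => h x) ((h y).resolve_right hνy) x hy.symm

theorem manOptimal_iff [Finite V] (hF : R.Fits I) (μ : Fin n ≃ Fin n) :
    I.ManOptimal μ ↔ μ = R.matching ∅ := by
  have h0 : I.Stable (R.matching ∅) := matching_stable hF isLowerSet_empty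
  have h1 : ∀ m, R.matching ∅ m = m := fun m => matching_of_notMem (Set.notMem_empty _)
  constructor
  · intro h
    ext m
    congr 1
    refine I.manRank_injective m (le_antisymm (h.2 _ h0 m) ?_)
    rw [h1]
    exact man_optimal hF h.1 m
  · rintro rfl
    exact ⟨h0, fun μ' hμ' m => by rw [h1]; exact man_optimal hF hμ' m⟩

/-! ### Rotations exposed in a stable matching -/

theorem nextWoman_of_notMem (hF : R.Fits I) {m w : Fin n} (hm : R.own m ∉ D)
    (h : I.NextWoman (R.matching D) m w) :
    (w = R.σ m ∧ ∀ w', R.Blocks m w' → R.own w' ∈ D) ∨ (R.Blocks m w ∧ R.own w ∉ D) := by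
  obtain ⟨h1, h2, h3⟩ := h
  rw [matching_of_notMem hm] at h1 h3
  have hσ : R.own (R.σ m) ∉ D := by rwa [R.own_σ]
  have h4 := h3 (R.σ m) (hF.man_self m)
  have h5 := hF.woman_self (R.σ m)
  rw [matching_symm_of_notMem hσ] at h4
  rw [Equiv.symm_apply_apply] at h5
  by_cases hs : R.Special m w
  · rcases hs with rfl | rfl | hs
    · omega
    · refine Or.inl ⟨rfl, fun w' hw' => ?_⟩
      by_contra hD
      have h6 := hF.man_blocks m w' hw'
      have h7 := h3 w' h6.1 h6.2
      rw [matching_symm_of_notMem hD] at h7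
      exact h7 (hF.woman_blocks m w' hw').2
    · refine Or.inr ⟨hs, fun hw => ?_⟩
      rw [matching_symm_of_mem hw] at h2
      have := hF.woman_blocks m w hs
      omega
  · have := hF.man_other m w hs
    exact absurd h5 (h4 (by omega))

/-- A woman who would accept a man already turned cannot rank him in her last section, so he must be
one of her far predecessors. This strict advance is what later excludes a cycle of such men. -/
theorem nextWoman_of_mem (hF : R.Fits I) {m w : Fin n} (hm : R.own m ∈ D)
    (h : I.NextWoman (R.matching D) m w) : R.bg m + 1 < R.bg w := by
  obtain ⟨h1, h2, -⟩ := h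
  rw [matching_of_mem hm] at h1
  have hm1 := hF.man_self m
  have hs : ¬ R.Special m w := by
    rintro (rfl | rfl | h)
    · omega
    · omega
    · have := hF.man_blocks m w h; omega
  have h4 := hF.woman_other m w hs
  have h5 := hF.woman_self w
  by_cases hw : R.own w ∈ D
  · rw [matching_symm_of_mem hw] at h2; omega
  · rw [matching_symm_of_notMem hw] at h2; omega

theorem nextWoman_σ (hF : R.Fits I) {m : Fin n} (hm : R.own m ∉ D)
    (hb : ∀ w, R.Blocks m w → R.own w ∈ D) : I.NextWoman (R.matching D) m (R.σ m) := by
  have hσ : R.own (R.σ m) ∉ D := by rwa [R.own_σ]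
  rw [SMInstance.NextWoman, matching_of_notMem hm, matching_symm_of_notMem hσ]
  have h5 := hF.woman_self (R.σ m)
  rw [Equiv.symm_apply_apply] at h5
  refine ⟨hF.man_self m, h5, fun w h1 h2 => ?_⟩
  have hs : R.Blocks m w := by
    by_contra hs
    have : ¬ R.Special m w := by
      rintro (rfl | rfl | h)
      · omega
      · omega
      · exact hs h
    have := hF.man_other m w this
    omega
  rw [matching_symm_of_mem (hb w hs)]
  have := hF.woman_blocks m w hs
  omega

variable (R) in
/-- The rotation that turns the cycle of `v`. -/
noncomputable def rot (v : V) : Cycle (Fin n × Fin n) :=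
  ((R.σ.toList (R.own_surjective v).choose).map fun x => (x, x) : List (Fin n × Fin n))

theorem mem_rot {v : V} {a : Fin n × Fin n} : a ∈ R.rot v ↔ a.1 = a.2 ∧ R.own a.1 = v := by
  have hx := (R.own_surjective v).choose_spec
  obtain ⟨a, b⟩ := a
  simp only [rot, Cycle.mem_coe_iff, List.mem_map, Prod.mk.injEq, Equiv.Perm.mem_toList_iff,
    Equiv.Perm.mem_support]
  constructor
  · rintro ⟨x, ⟨h, -⟩, rfl, rfl⟩
    refine ⟨rfl, ?_⟩
    rw [← hx]
    obtain ⟨i, rfl⟩ := h.exists_nat_pow_eq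
    clear hx h
    induction i with
    | zero => rfl
    | succ i IH => rw [pow_succ', Equiv.Perm.mul_apply, R.own_σ, IH]
  · rintro ⟨rfl, h⟩
    exact ⟨a, ⟨R.sameCycle _ _ (hx.trans h.symm), R.σ_ne _⟩, rfl, rfl⟩

theorem rot_nodup (v : V) : (R.rot v).Nodup := by
  rw [rot, Cycle.nodup_coe_iff]
  exact (Equiv.Perm.nodup_toList _ _).map fun a b h => (Prod.mk.inj h).1

theorem rot_next {v : V} {a : Fin n × Fin n} (ha : a ∈ R.rot v) :
    (R.rot v).next (rot_nodup v) a ha = (R.σ a.1, R.σ a.1) := by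
  obtain ⟨x, y⟩ := a
  obtain rfl : x = y := (mem_rot.1 ha).1
  have h : (R.rot v).Chain fun a b => b = (R.σ a.1, R.σ a.1) := by
    rw [rot, ← Cycle.map_coe, Cycle.chain_map,
      Cycle.chain_iff_forall_next _ (Cycle.nodup_coe_iff.2 (Equiv.Perm.nodup_toList _ _))]
    intro b hb
    rw [show Cycle.next _ _ b hb = _ from Equiv.Perm.next_toList_eq_apply _ _ _ hb]
  exact (Cycle.chain_iff_forall_next _ (rot_nodup v)).1 h _ ha

theorem rot_injective : Function.Injective R.rot := by
  intro u v h
  obtain ⟨x, rfl⟩ := R.own_surjective u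
  have : (x, x) ∈ R.rot (R.own x) := mem_rot.2 ⟨rfl, rfl⟩
  rw [h] at this
  exact (mem_rot.1 this).2

/-- When everything below `v` is turned, every blocker already has her better partner and refuses,
so each man of the cycle of `v` proceeds directly to `σ m`. -/
theorem exposed_rot (hF : R.Fits I) (hD : IsLowerSet D) {v : V} (hv : v ∉ D)
    (hlt : ∀ u, u < v → u ∈ D) : I.Exposed (R.matching D) (R.rot v) := by
  refine ⟨matching_stable hF hD, ?_, rot_nodup v, ?_, ?_⟩
  · intro h
    obtain ⟨x, rfl⟩ := R.own_surjective v
    have : (x, x) ∈ R.rot (R.own x) := mem_rot.2 ⟨rfl, rfl⟩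
    rw [h] at this
    exact Cycle.notMem_nil _ this
  · intro a ha
    obtain ⟨h1, rfl⟩ := mem_rot.1 ha
    rw [matching_of_notMem hv, h1]
  · rw [Cycle.chain_iff_forall_next _ (rot_nodup v)]
    intro a ha
    rw [rot_next]
    obtain ⟨h1, rfl⟩ := mem_rot.1 ha
    exact nextWoman_σ hF hv fun w hw => hlt _ hw.2.lt

/-- Going once around the rotation, any quantity that changes monotonically must be constant, and
none can change strictly. For turned men the group number would increase strictly, so all men are
unturned. For unturned men the vertex weakly decreases, so it is constant; every step is then a step
of `σ`, and all blockers are turned. -/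
theorem eq_rot_of_exposed [Finite V] (hF : R.Fits I) {ρ : Cycle (Fin n × Fin n)}
    (h : I.Exposed (R.matching D) ρ) (hD : IsLowerSet D) :
    ∃ v, v ∉ D ∧ (∀ u, u < v → u ∈ D) ∧ ρ = R.rot v := by
  obtain ⟨-, hnil, hnd, hμ, hch⟩ := h
  have hnext := (Cycle.chain_iff_forall_next ρ hnd).1 hch
  have hex : ∃ a, a ∈ ρ := by
    induction ρ using Quotient.inductionOn' with | _ l
    rcases l with _ | ⟨a, l⟩
    · exact absurd rfl hnil
    · exact ⟨a, List.mem_cons_self⟩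
  -- On a cycle, a transitive relation between neighbours holds between any two members, including a
  -- member and itself.
  have pairwise : ∀ r : Fin n × Fin n → Fin n × Fin n → Prop, IsTrans _ r →
      (∀ a (ha : a ∈ ρ), r a (ρ.next hnd a ha)) → ∀ a ∈ ρ, ∀ b ∈ ρ, r a b := fun r _ hr =>
    Cycle.chain_iff_pairwise.1 ((Cycle.chain_iff_forall_next ρ hnd).2 hr)
  have fst_eq : ∀ a ∈ ρ, R.own a.1 ∉ D → a.2 = a.1 := fun a ha h => by
    rw [← hμ a ha, matching_of_notMem h]
  have own_snd : ∀ a ∈ ρ, R.own a.2 = R.own a.1 := fun a ha => by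
    rw [← hμ a ha, own_matching]
  have hcl : ∀ a ∈ ρ, ∀ b ∈ ρ, R.own a.1 ∉ D → R.own b.1 ∉ D := by
    refine pairwise _ ⟨fun a b c h1 h2 h => h2 (h1 h)⟩ fun a ha h => ?_
    rw [← own_snd _ (ρ.next_mem hnd a ha)]
    rcases nextWoman_of_notMem hF h (hnext a ha) with h1 | h1
    · rwa [h1.1, R.own_σ]
    · exact h1.2
  have hne : ∀ a ∈ ρ, R.own a.1 ∉ D := by
    intro a ha h
    have hall : ∀ b ∈ ρ, R.own b.1 ∈ D := fun b hb => by
      by_contra h'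
      exact hcl b hb a ha h' h
    have := pairwise (fun a b => R.bg a.1 < R.bg b.1) ⟨fun a b c => lt_trans⟩ ?_ a ha a ha
    -- The next woman is `σ b.1`, more than one group after `a.1`; as `σ` advances by at most one
    -- group, `b.1` itself lies strictly after `a.1`.
    · exact lt_irrefl _ this
    · intro a ha
      have hb := ρ.next_mem hnd a ha
      set b := ρ.next hnd a ha
      have h1 := nextWoman_of_mem hF (hall a ha) (hnext a ha)
      have h2 := hμ b hb
      rw [matching_of_mem (hall b hb)] at h2
      have h3 := R.bg_σ_le b.1
      rw [h2] at h3
      change R.bg a.1 + 1 < R.bg b.2 at h1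
      omega
  obtain ⟨a₀, ha₀⟩ := hex
  have hown : ∀ a ∈ ρ, R.own a.1 = R.own a₀.1 := by
    have := pairwise (fun a b => R.own b.1 ≤ R.own a.1) ⟨fun a b c h1 h2 => h2.trans h1⟩ ?_
    · exact fun a ha => le_antisymm (this _ ha₀ _ ha) (this _ ha _ ha₀)
    · intro a ha
      rw [← own_snd _ (ρ.next_mem hnd a ha)]
      rcases nextWoman_of_notMem hF (hne a ha) (hnext a ha) with h1 | h1
      · rw [h1.1, R.own_σ]
      · exact h1.1.2.le
  have hstep : ∀ a (ha : a ∈ ρ), ρ.next hnd a ha = (R.σ a.1, R.σ a.1) ∧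
      ∀ w', R.Blocks a.1 w' → R.own w' ∈ D := by
    intro a ha
    have hb := ρ.next_mem hnd a ha
    rcases nextWoman_of_notMem hF (hne a ha) (hnext a ha) with h1 | h1
    · refine ⟨?_, h1.2⟩
      exact Prod.ext (by rw [← fst_eq _ hb (hne _ hb), h1.1]) h1.1
    · have h2 := h1.1.2.lt
      rw [own_snd _ hb, hown _ hb, hown _ ha] at h2
      exact absurd h2 (lt_irrefl _)
  have hmem : ∀ x, R.own x = R.own a₀.1 → (x, x) ∈ ρ := by
    intro x hx
    obtain ⟨i, rfl⟩ := (R.sameCycle _ _ hx.symm).exists_nat_pow_eq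
    clear hx
    induction i with
    | zero =>
      have := fst_eq a₀ ha₀ (hne a₀ ha₀)
      change (a₀.1, a₀.1) ∈ ρ
      nth_rewrite 2 [← this]
      exact ha₀
    | succ i IH =>
      have := ρ.next_mem hnd _ IH
      rw [(hstep _ IH).1] at this
      rwa [pow_succ', Equiv.Perm.mul_apply]
  have hiff : ∀ a, a ∈ ρ ↔ a ∈ R.rot (R.own a₀.1) := by
    intro a
    rw [mem_rot]
    constructor
    · exact fun ha => ⟨(fst_eq a ha (hne a ha)).symm, hown a ha⟩
    · rintro ⟨h1, h2⟩
      have := hmem _ h2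
      nth_rewrite 2 [h1] at this
      exact this
  refine ⟨R.own a₀.1, hne _ ha₀, fun u hu => ?_, ?_⟩
  -- It suffices to reach a lower cover `u'` of the vertex above `u`: that cover meets the cycle in
  -- a group and is a blocker, hence turned.
  · obtain ⟨u', h1, h2⟩ := exists_le_covBy_of_lt hu
    obtain ⟨x, y, hxy, rfl, hy⟩ := R.exists_of_covBy _ _ h2
    exact hD h1 ((hstep _ (hmem y hy)).2 x ⟨hxy, by rwa [hy]⟩)
  · refine Cycle.eq_of_mem_iff_of_next_eq hnd (rot_nodup _) ?_ hiff fun a ha hb => ?_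
    · refine ⟨_, _, ?_, ha₀, ρ.next_mem hnd a₀ ha₀⟩
      rw [(hstep _ ha₀).1]
      exact fun h => R.σ_ne _ (congrArg Prod.fst h).symm
    · rw [rot_next, (hstep a ha).1]

theorem elimination_rot {v : V} (hv : v ∉ D) :
    SMInstance.Elimination (R.matching D) (R.rot v) (R.matching (insert v D)) := by
  rw [SMInstance.Elimination]
  ext ⟨m, w⟩
  have hcons : (∃ a b, SMInstance.Consecutive (R.rot v) a b ∧ (m, w) = (a.1, b.2)) ↔
      R.own m = v ∧ w = R.σ m := by
    constructor
    · rintro ⟨a, b, ⟨hnd, ha, rfl⟩, h⟩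
      rw [rot_next ha] at h
      rw [Prod.mk.injEq] at h
      obtain ⟨rfl, rfl⟩ := h
      exact ⟨(mem_rot.1 ha).2, rfl⟩
    · rintro ⟨h, rfl⟩
      have ha : (m, m) ∈ R.rot v := mem_rot.2 ⟨rfl, h⟩
      exact ⟨_, _, ⟨rot_nodup v, ha, rfl⟩, by rw [rot_next]⟩
  simp only [Set.mem_ofPred_eq, Set.mem_union, Set.mem_sdiff, hcons, mem_rot]
  by_cases hm : R.own m = v
  · have h1 : R.own m ∉ D := by rwa [hm]
    rw [matching_of_notMem h1, matching_of_mem (by rw [hm]; exact Set.mem_insert v D)]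
    simp [hm, eq_comm]
  · by_cases hD : R.own m ∈ D
    · rw [matching_of_mem hD, matching_of_mem (Set.mem_insert_of_mem v hD)]
      simp [hm]
    · rw [matching_of_notMem hD, matching_of_notMem (by simp [hm, hD])]
      simp [hm]

/-! ### Elimination sequences and the rotation poset -/

theorem eliminationSeq_eq [Finite V] (hF : R.Fits I) {L : List (Cycle (Fin n × Fin n))}
    {μ : Fin n ≃ Fin n} (h : I.EliminationSeq L μ) :
    ∃ D, IsLowerSet D ∧ μ = R.matching D ∧ ∀ ρ, ρ ∈ L ↔ ∃ v ∈ D, ρ = R.rot v := by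
  induction h with
  | start μ h => exact ⟨∅, isLowerSet_empty, (manOptimal_iff hF μ).1 h, by simp⟩
  | step L ρ μ μ' h hρ hμ IH =>
    obtain ⟨D, hD, rfl, hL⟩ := IH
    obtain ⟨v, hv, hlt, rfl⟩ := eq_rot_of_exposed hF hρ hD
    refine ⟨insert v D, ?_, hμ.unique (elimination_rot hv), ?_⟩
    · intro a b hba ha
      rcases ha with rfl | ha
      · rcases hba.eq_or_lt with rfl | hlt'
        · exact Set.mem_insert _ _
        · exact Set.mem_insert_of_mem _ (hlt b hlt')
      · exact Set.mem_insert_of_mem _ (hD hba ha)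
    · intro ρ
      simp [hL]

/-- Removing a maximal element of `D` leaves a lower set, whose matching exposes the rotation of the
removed element. -/
theorem exists_eliminationSeq [Finite V] (hF : R.Fits I) (hD : IsLowerSet D) :
    ∃ L, I.EliminationSeq L (R.matching D) := by
  induction hk : D.ncard using Nat.strong_induction_on generalizing D with | _ k IH
  rcases D.eq_empty_or_nonempty with rfl | hne
  · exact ⟨[], .start _ ((manOptimal_iff hF _).2 rfl)⟩
  obtain ⟨v, hv⟩ := D.toFinite.exists_maximal hne
  have hD' : IsLowerSet (D \ {v}) := by
    rintro a b hba ⟨ha, hav⟩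
    refine ⟨hD hba ha, fun hb => hav ?_⟩
    obtain rfl : b = v := hb
    exact le_antisymm (hv.2 ha hba) hba
  obtain ⟨L, hL⟩ := IH _ (hk ▸ Set.ncard_sdiff_singleton_lt_of_mem hv.1) hD' rfl
  refine ⟨R.rot v :: L, .step L _ _ _ hL (exposed_rot hF hD' (by simp) fun u hu => ?_) ?_⟩
  · exact ⟨hD hu.le hv.1, hu.ne⟩
  · have := elimination_rot (R := R) (D := D \ {v}) (v := v) (by simp)
    rwa [Set.insert_sdiff_singleton, Set.insert_eq_of_mem hv.1] at this

theorem eliminated_matching [Finite V] (hF : R.Fits I) (hD : IsLowerSet D) :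
    I.eliminated (R.matching D) = R.rot '' D := by
  ext ρ
  constructor
  · rintro ⟨L, hL, hρ⟩
    obtain ⟨D', hD', h1, h2⟩ := eliminationSeq_eq hF hL
    rw [matching_injective h1]
    obtain ⟨v, hv, rfl⟩ := (h2 ρ).1 hρ
    exact ⟨v, hv, rfl⟩
  · rintro ⟨v, hv, rfl⟩
    obtain ⟨L, hL⟩ := exists_eliminationSeq hF hD
    obtain ⟨D', hD', h1, h2⟩ := eliminationSeq_eq hF hL
    exact ⟨L, hL, (h2 _).2 ⟨v, by rwa [← matching_injective h1], rfl⟩⟩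

theorem rot_mem_rotations (hF : R.Fits I) (v : V) : R.rot v ∈ I.rotations :=
  ⟨_, exposed_rot hF (isLowerSet_Iio v) (by simp) fun _ h => h⟩

/-- The matching of the elements strictly below `v` exposes the rotation of `v` having eliminated
nothing else, which tests the relation. Conversely, wherever that rotation is exposed, everything
below `v` is already turned. -/
theorem precedes_iff [Finite V] (hF : R.Fits I) (u v : V) :
    I.Precedes ⟨R.rot u, rot_mem_rotations hF u⟩ ⟨R.rot v, rot_mem_rotations hF v⟩ ↔ u < v := by
  constructor
  · intro h
    have := h _ (exposed_rot hF (isLowerSet_Iio v) (by simp) fun _ h => h)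
    rw [eliminated_matching hF (isLowerSet_Iio v)] at this
    obtain ⟨u', h1, h2⟩ := this
    rwa [← rot_injective h2]
  · intro h μ hμ
    obtain ⟨D, hD, rfl⟩ := eq_matching_of_stable hF hμ.1
    obtain ⟨v', hv', hlt, h1⟩ := eq_rot_of_exposed hF hμ hD
    rw [eliminated_matching hF hD]
    exact ⟨u, hlt u (by rwa [← rot_injective h1]), rfl⟩

theorem realizes [Finite V] (hF : R.Fits I) : I.Realizes V := by
  let f : V → I.rotations := fun v => ⟨R.rot v, rot_mem_rotations hF v⟩
  have hf : Function.Bijective f := by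
    constructor
    · intro u v h
      exact rot_injective (congrArg Subtype.val h)
    · rintro ⟨ρ, μ, hμ⟩
      obtain ⟨D, hD, rfl⟩ := eq_matching_of_stable hF hμ.1
      obtain ⟨v, -, -, rfl⟩ := eq_rot_of_exposed hF hμ hD
      exact ⟨v, rfl⟩
  exact ⟨⟨Equiv.ofBijective f hf, fun {u v} => precedes_iff hF u v⟩⟩

end RotationFrame

/-! ### Preference lists that are sorted up to a local change -/

open Classical in
/-- The section of the list of the agent `a` that contains the agent `x`: far predecessors come
first, then `F`, then the close neighbours, then `S`, then everybody else. -/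
noncomputable def listSection {α : Type*} (bg : α → ℕ) (adj : α → Prop) (a F S x : α) : ℕ :=
  if bg x + 1 < bg a then 0 else if x = F then 1 else if bg x = bg a ∧ adj x then 2 else
    if x = S then 3 else 4

theorem listSection_le {α : Type*} (bg : α → ℕ) (adj : α → Prop) (a F S x : α) :
    listSection bg adj a F S x ≤ 4 := by
  unfold listSection
  split_ifs <;> omega

theorem listSection_comp {α β : Type*} {f : α → β} (hf : Function.Injective f) (bg : β → ℕ)
    (adj : β → Prop) (a F S x : α) :
    listSection bg adj (f a) (f F) (f S) (f x) =
      listSection (fun x => bg (f x)) (fun x => adj (f x)) a F S x := by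
  have hne : ∀ y, x ≠ y → f x ≠ f y := fun y => hf.ne
  by_cases hF : x = F <;> by_cases hS : x = S <;> simp_all [listSection]

theorem card_filter_lt_strictMono {n : ℕ} (key : Fin n → ℕ) {x y : Fin n} (hxy : key x < key y) :
    (Finset.univ.filter fun z => key z < key x).card <
      (Finset.univ.filter fun z => key z < key y).card := by
  refine Finset.card_lt_card ((Finset.ssubset_iff_of_subset fun z hz => ?_).2
    ⟨x, by simpa using hxy, by simp⟩)
  simp only [Finset.mem_filter, Finset.mem_univ, true_and] at hz ⊢
  omega

/-- The bijection that numbers `Fin n` in the order given by `key`. -/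
noncomputable def rankEquiv {n : ℕ} (key : Fin n → ℕ) (h : Function.Injective key) :
    Fin n ≃ Fin n :=
  Equiv.ofBijective
    (fun x => ⟨(Finset.univ.filter fun y => key y < key x).card, by
      conv_rhs => rw [← Fintype.card_fin n, ← Finset.card_univ]
      exact Finset.card_lt_card (Finset.filter_ssubset.2 ⟨x, Finset.mem_univ x, lt_irrefl _⟩)⟩)
    (Finite.injective_iff_bijective.1 fun x y hxy => by
      have hxy' := congrArg Fin.val hxy
      simp only at hxy'
      rcases lt_trichotomy (key x) (key y) with h1 | h1 | h1
      · have := card_filter_lt_strictMono key h1; omega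
      · exact h h1
      · have := card_filter_lt_strictMono key h1; omega)

theorem rankEquiv_val {n : ℕ} (key : Fin n → ℕ) (h : Function.Injective key) (x : Fin n) :
    (rankEquiv key h x : ℕ) = (Finset.univ.filter fun y => key y < key x).card := rfl

theorem rankEquiv_lt {n : ℕ} (key : Fin n → ℕ) (h : Function.Injective key) {x y : Fin n}
    (hxy : key x < key y) : (rankEquiv key h x : ℕ) < rankEquiv key h y :=
  card_filter_lt_strictMono key hxy

/-- The sorting key of a list that consists of sections, every section being sorted by number. -/
def listKey {n : ℕ} (sec : Fin n → ℕ) (x : Fin n) : ℕ := sec x * n + x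

theorem listKey_lt {n : ℕ} {sec : Fin n → ℕ} {x y : Fin n} (h : sec x < sec y) :
    listKey sec x < listKey sec y := by
  have := Nat.mul_le_mul_right n (Nat.succ_le_of_lt h)
  have := x.2
  unfold listKey
  rw [Nat.succ_mul] at *
  omega

theorem listKey_lt_of_eq {n : ℕ} {sec : Fin n → ℕ} {x y : Fin n} (h : sec x = sec y)
    (hxy : x < y) : listKey sec x < listKey sec y := by
  have : (x : ℕ) < y := hxy
  unfold listKey
  rw [h]
  omega

theorem listKey_injective {n : ℕ} (sec : Fin n → ℕ) : Function.Injective (listKey sec) := by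
  intro x y h
  by_contra hne
  rcases lt_trichotomy (sec x) (sec y) with h1 | h1 | h1
  · exact (listKey_lt h1).ne h
  · rcases lt_or_gt_of_ne hne with h2 | h2
    · exact (listKey_lt_of_eq h1 h2).ne h
    · exact (listKey_lt_of_eq h1.symm h2).ne' h
  · exact (listKey_lt h1).ne' h

/-- In a list whose exceptional agents come from the groups around that of `a`, no agent is far
from its place in the sorted list. -/
theorem rank_bounds {n c : ℕ} {bg : Fin n → ℕ} (hbg : Monotone bg)
    (hc : ∀ i, (Finset.univ.filter fun x => bg x = i).card ≤ c) (adj : Fin n → Prop)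
    (a F S x : Fin n) (hF : bg F ≤ bg a + 1) (hS : bg S ≤ bg a + 1) :
    (x : ℕ) ≤ rankEquiv _ (listKey_injective (listSection bg adj a F S)) x + 3 * c ∧
      (rankEquiv _ (listKey_injective (listSection bg adj a F S)) x : ℕ) ≤ x + c + 2 := by
  rw [rankEquiv_val]
  set sec := listSection bg adj a F S with hsec
  have hle : ∀ y, sec y ≤ 4 := listSection_le bg adj a F S
  have h0 : ∀ y, sec y = 0 ↔ bg y + 1 < bg a := fun y => by
    simp only [hsec, listSection]
    split_ifs <;> simp_all
  have h4 : ∀ y, sec y ≠ 0 → sec y ≠ 4 → y = F ∨ y = S ∨ bg y = bg a := fun y => by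
    simp only [hsec, listSection]
    split_ifs <;> simp_all
  have hlt : ∀ y z : Fin n, bg y < bg z → y < z := fun y z h => by
    by_contra h'
    have := hbg (not_lt.1 h')
    omega
  have hcard : ∀ x : Fin n, (Finset.univ.filter fun y => y < x).card = x := fun x => by
    rw [Finset.filter_gt_eq_Iio, Fin.card_Iio]
  constructor
  · have hsub : (Finset.univ.filter fun y => y < x) ⊆
        (Finset.univ.filter fun y => listKey sec y < listKey sec x) ∪
          ((Finset.univ.filter fun y => bg y = bg x) ∪
            ((Finset.univ.filter fun y => bg y = bg x - 1) ∪
              (Finset.univ.filter fun y => bg y = bg x - 2))) := by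
      intro y hy
      simp only [Finset.mem_filter, Finset.mem_univ, true_and, Finset.mem_union] at hy ⊢
      have hyx := hbg hy.le
      by_cases h : listKey sec y < listKey sec x
      · exact Or.inl h
      right
      -- If a smaller number is not placed earlier, `x` must have been pulled forward, so it lies in
      -- section 1, 2 or 3 and at most one group beyond `a`. The overtaken agents are not far
      -- predecessors of `a`, hence lie at most two groups before `x`.
      have hx4 : sec x ≠ 4 := fun hx => h <| by
        rcases (hle y).lt_or_eq with h1 | h1
        · exact listKey_lt (by omega)
        · exact listKey_lt_of_eq (by omega) hy
      have hx0 : sec x ≠ 0 := fun hx => h <| by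
        have := (h0 x).1 hx
        exact listKey_lt_of_eq (((h0 y).2 (by omega)).trans hx.symm) hy
      have hxa : bg x ≤ bg a + 1 := by
        rcases h4 x hx0 hx4 with rfl | rfl | h
        · exact hF
        · exact hS
        · omega
      have hy0 : sec y ≠ 0 := fun hy => h (listKey_lt (by omega))
      rw [Ne, h0] at hy0
      omega
    have h1 := Finset.card_le_card hsub
    rw [hcard] at h1
    have h2 := hc (bg x)
    have h3 := hc (bg x - 1)
    have h4 := hc (bg x - 2)
    have h5 := Finset.card_union_le (Finset.univ.filter fun y => listKey sec y < listKey sec x)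
      ((Finset.univ.filter fun y => bg y = bg x) ∪
            ((Finset.univ.filter fun y => bg y = bg x - 1) ∪
              (Finset.univ.filter fun y => bg y = bg x - 2)))
    have h6 := Finset.card_union_le (Finset.univ.filter fun y => bg y = bg x)
            ((Finset.univ.filter fun y => bg y = bg x - 1) ∪
              (Finset.univ.filter fun y => bg y = bg x - 2))
    have h7 := Finset.card_union_le (Finset.univ.filter fun y => bg y = bg x - 1)
              (Finset.univ.filter fun y => bg y = bg x - 2)
    omega
  · have hsub : (Finset.univ.filter fun y => listKey sec y < listKey sec x) ⊆
        (Finset.univ.filter fun y => y < x) ∪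
          ((Finset.univ.filter fun y => bg y = bg a) ∪ {F, S}) := by
      intro y hy
      simp only [Finset.mem_filter, Finset.mem_univ, true_and, Finset.mem_union,
        Finset.mem_insert, Finset.mem_singleton] at hy ⊢
      by_cases hyx : y < x
      · exact Or.inl hyx
      right
      have hxy := hbg (not_lt.1 hyx)
      -- Sections 0 and 4 preserve the numbering, because the far predecessors form an initial
      -- segment. Only the group of `a` and the agents `F`, `S` can overtake a smaller number.
      have hy4 : sec y ≠ 4 := fun hy4 => by
        rcases (hle x).lt_or_eq with h1 | h1
        · exact absurd (listKey_lt (show sec x < sec y by omega)) (by omega)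
        · rcases (not_lt.1 hyx).eq_or_lt with h2 | h2
          · rw [h2] at hy; omega
          · exact absurd (listKey_lt_of_eq (show sec x = sec y by omega) h2) (by omega)
      have hy0 : sec y ≠ 0 := fun hy0 => by
        have h1 := (h0 y).1 hy0
        have h2 := (h0 x).2 (by omega)
        rcases (not_lt.1 hyx).eq_or_lt with h3 | h3
        · rw [h3] at hy; omega
        · exact absurd (listKey_lt_of_eq (show sec x = sec y by omega) h3) (by omega)
      rcases h4 y hy0 hy4 with h | h | h
      · exact Or.inr (Or.inl h)
      · exact Or.inr (Or.inr h)
      · exact Or.inl h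
    have h1 := Finset.card_le_card hsub
    have h2 := hc (bg a)
    have h3 := Finset.card_union_le (Finset.univ.filter fun y => y < x)
      ((Finset.univ.filter fun y => bg y = bg a) ∪ {F, S})
    have h5 := Finset.card_union_le (Finset.univ.filter fun y => bg y = bg a) {F, S}
    have h6 := Finset.card_le_two (a := F) (b := S)
    rw [hcard] at h3
    omega

/-! ### The instance of a frame and its range -/

namespace RotationFrame

variable {V : Type*} [PartialOrder V] {n : ℕ} (R : RotationFrame V n)

/-- The sections of the list of the man `m`. -/
noncomputable def manSection (m : Fin n) : Fin n → ℕ :=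
  listSection R.bg (fun w => R.own w ⋖ R.own m) m m (R.σ m)

/-- The sections of the list of the woman `w`. -/
noncomputable def womanSection (w : Fin n) : Fin n → ℕ :=
  listSection R.bg (fun m => R.own w ⋖ R.own m) w (R.σ.symm w) w

/-- The instance with the preferences that the frame prescribes. -/
noncomputable def toInstance : SMInstance n where
  man m := (rankEquiv _ (listKey_injective (R.manSection m))).symm
  woman w := (rankEquiv _ (listKey_injective (R.womanSection w))).symm

theorem toInstance_manRank (m w : Fin n) : R.toInstance.manRank m w =
    rankEquiv _ (listKey_injective (R.manSection m)) w + 1 := by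
  simp [SMInstance.manRank, toInstance]

theorem toInstance_womanRank (w m : Fin n) : R.toInstance.womanRank w m =
    rankEquiv _ (listKey_injective (R.womanSection w)) m + 1 := by
  simp [SMInstance.womanRank, toInstance]

theorem manRank_lt {m w w' : Fin n} (h : R.manSection m w < R.manSection m w') :
    R.toInstance.manRank m w < R.toInstance.manRank m w' := by
  rw [toInstance_manRank, toInstance_manRank]
  exact Nat.succ_lt_succ (rankEquiv_lt _ _ (listKey_lt h))

theorem womanRank_lt {w m m' : Fin n} (h : R.womanSection w m < R.womanSection w m') :
    R.toInstance.womanRank w m < R.toInstance.womanRank w m' := by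
  rw [toInstance_womanRank, toInstance_womanRank]
  exact Nat.succ_lt_succ (rankEquiv_lt _ _ (listKey_lt h))

/-- The front section starts only at distance two, so the partners `σ m` and `σ⁻¹ w`, possibly one
group back, are never swallowed by it. The five sections then have exactly the prescribed order. -/
theorem fits_toInstance : R.Fits R.toInstance := by
  have hm1 : ∀ m, R.manSection m m = 1 := fun m => by simp [manSection, listSection]
  have hm3 : ∀ m, R.manSection m (R.σ m) = 3 := fun m => by
    have := R.le_bg_σ m
    simp [manSection, listSection, R.σ_ne m, R.own_σ, this]
  have hm2 : ∀ m w, R.Blocks m w → R.manSection m w = 2 := fun m w h => by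
    have : w ≠ m := fun h' => h.2.ne (congrArg R.own h')
    simp [manSection, listSection, h.1, h.2, this]
  have hw1 : ∀ w, R.womanSection w (R.σ.symm w) = 1 := fun w => by
    have := R.bg_σ_le (R.σ.symm w)
    rw [Equiv.apply_symm_apply] at this
    simp [womanSection, listSection, this]
  have hne : ∀ w, w ≠ R.σ.symm w := fun w h => by
    rw [Equiv.eq_symm_apply] at h
    exact R.σ_ne w h
  have hw3 : ∀ w, R.womanSection w w = 3 := fun w => by
    simp [womanSection, listSection, hne]
  have hw2 : ∀ m w, R.Blocks m w → R.womanSection w m = 2 := fun m w h => by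
    have : m ≠ R.σ.symm w := fun h' => h.2.ne (by rw [h', R.own_symm])
    simp [womanSection, listSection, h.1, h.2, this]
  refine ⟨fun m => R.manRank_lt ?_, fun m w h => ⟨R.manRank_lt ?_, R.manRank_lt ?_⟩,
    fun m w h => ?_, fun w => R.womanRank_lt ?_,
    fun m w h => ⟨R.womanRank_lt ?_, R.womanRank_lt ?_⟩, fun m w h => ?_⟩
  · rw [hm1, hm3]; decide
  · rw [hm1, hm2 m w h]; decide
  · rw [hm2 m w h, hm3]; decide
  · simp only [Special, Blocks, not_or] at h
    by_cases hb : R.bg w + 1 < R.bg m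
    · refine Or.inl ⟨hb, R.manRank_lt ?_⟩
      rw [hm1, manSection, listSection, if_pos hb]; decide
    · refine Or.inr ⟨hb, R.manRank_lt ?_⟩
      rw [hm3, manSection, listSection, if_neg hb, if_neg h.1, if_neg h.2.2, if_neg h.2.1]; decide
  · rw [hw1, hw3]; decide
  · rw [hw1, hw2 m w h]; decide
  · rw [hw2 m w h, hw3]; decide
  · simp only [Special, Blocks, not_or] at h
    by_cases hb : R.bg m + 1 < R.bg w
    · refine Or.inl ⟨hb, R.womanRank_lt ?_⟩
      rw [hw1, womanSection, listSection, if_pos hb]; decide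
    · refine Or.inr ⟨hb, R.womanRank_lt ?_⟩
      rw [hw3, womanSection, listSection, if_neg hb,
        if_neg (fun h' => h.2.1 (by rw [h', Equiv.apply_symm_apply])),
        if_neg (fun h' => h.2.2 ⟨h'.1.symm, h'.2⟩), if_neg (fun h' => h.1 h'.symm)]
      decide

/-- Every rank of `x` lies in a window around its own number that does not depend on the ranking
agent; its width is `3c` below plus `c + 2` above, and the range adds one. -/
theorem range_toInstance_le [Nonempty (Fin n)] {c : ℕ}
    (hc : ∀ i, (Finset.univ.filter fun x => R.bg x = i).card ≤ c) :
    R.toInstance.range ≤ 4 * c + 3 := by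
  have hspread : ∀ (x : ℕ) (f : Fin n → ℕ), (∀ a, x ≤ f a + 3 * c ∧ f a ≤ x + c + 2) →
      (Finset.univ.sup fun a => f a + 1) - (⨅ a, (f a + 1)) ≤ 4 * c + 2 := by
    intro x f h
    have h1 : (Finset.univ.sup fun a => f a + 1) ≤ x + c + 3 :=
      Finset.sup_le fun a _ => by have := (h a).2; omega
    have h2 : x + 1 - 3 * c ≤ ⨅ a, (f a + 1) := le_ciInf fun a => by have := (h a).1; omega
    omega
  unfold SMInstance.range
  refine Nat.succ_le_succ (max_le (Finset.sup_le fun w _ => ?_) (Finset.sup_le fun m _ => ?_))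
  · simp only [SMInstance.womanSpread, toInstance_manRank]
    refine hspread w _ fun m => rank_bounds R.bg_mono hc _ _ _ _ _ (Nat.le_succ _) (R.bg_σ_le m)
  · simp only [SMInstance.manSpread, toInstance_womanRank]
    refine hspread m _ fun w => rank_bounds R.bg_mono hc _ _ _ _ _ ?_ (Nat.le_succ _)
    have := R.le_bg_σ (R.σ.symm w)
    rwa [Equiv.apply_symm_apply] at this

end RotationFrame

/-! ### Folding the occurrences of every letter of a word into a cycle -/

/-- `2 q + 1` for the last `q < j` with `f q = v`, and `0` if there is none. -/
def lastOcc (f : ℕ → ℕ) : ℕ → ℕ → ℕ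
  | 0 => fun _ => 0
  | j + 1 => Function.update (lastOcc f j) (f j) (2 * j + 1)

/-- The permutation whose cycles run through the agents `2 q` with `f q = v` upwards and through
the agents `2 q + 1` with `f q = v` downwards, for `q < j`. -/
def foldPerm (f : ℕ → ℕ) : ℕ → Equiv.Perm ℕ
  | 0 => 1
  | j + 1 =>
    foldPerm f j * if lastOcc f j (f j) = 0 then Equiv.swap (2 * j) (2 * j + 1) else
      Equiv.swap (lastOcc f j (f j) - 1) (2 * j) * Equiv.swap (2 * j) (2 * j + 1)

/-- `a < b` are consecutive occurrences of the same letter. -/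
def Consec (f : ℕ → ℕ) (a b : ℕ) : Prop :=
  a < b ∧ f a = f b ∧ ∀ z, a < z → z < b → f z ≠ f b

theorem lastOcc_eq_zero {f : ℕ → ℕ} {j v : ℕ} (h : lastOcc f j v = 0) : ∀ q < j, f q ≠ v := by
  induction j with
  | zero => exact fun q hq => absurd hq (Nat.not_lt_zero q)
  | succ j IH =>
    intro q hq hv
    rw [lastOcc] at h
    by_cases hj : v = f j
    · rw [hj, Function.update_self] at h; omega
    · rw [Function.update_of_ne hj] at h
      rcases Nat.lt_succ_iff_lt_or_eq.1 hq with h1 | rfl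
      · exact IH h q h1 hv
      · exact hj hv.symm

theorem exists_of_lastOcc_ne_zero {f : ℕ → ℕ} {j v : ℕ} (h : lastOcc f j v ≠ 0) :
    ∃ l < j, lastOcc f j v = 2 * l + 1 ∧ f l = v ∧ ∀ z, l < z → z < j → f z ≠ v := by
  induction j with
  | zero => exact absurd rfl h
  | succ j IH =>
    rw [lastOcc] at h ⊢
    by_cases hv : v = f j
    · subst hv
      exact ⟨j, by omega, by rw [Function.update_self], rfl, by omega⟩
    · rw [Function.update_of_ne hv] at h ⊢
      obtain ⟨l, hl, h1, h2, h3⟩ := IH h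
      refine ⟨l, by omega, h1, h2, fun z hz hzj => ?_⟩
      rcases Nat.lt_succ_iff_lt_or_eq.1 hzj with h5 | rfl
      · exact h3 z hz h5
      · exact fun h' => hv h'.symm

theorem foldPerm_apply_of_ge (f : ℕ → ℕ) {j x : ℕ} (hx : 2 * j ≤ x) : foldPerm f j x = x := by
  induction j with
  | zero => rfl
  | succ j IH =>
    rw [foldPerm, Equiv.Perm.mul_apply]
    split_ifs with h
    · rw [Equiv.swap_apply_of_ne_of_ne (x := x) (by omega) (by omega), IH (by omega)]
    · obtain ⟨l, hl, h1, -⟩ := exists_of_lastOcc_ne_zero h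
      rw [Equiv.Perm.mul_apply, Equiv.swap_apply_of_ne_of_ne (x := x) (by omega) (by omega),
        Equiv.swap_apply_of_ne_of_ne (x := x) (by omega) (by omega), IH (by omega)]

theorem foldPerm_succ_of_eq_zero {f : ℕ → ℕ} {j : ℕ} (h : lastOcc f j (f j) = 0) (x : ℕ) :
    foldPerm f (j + 1) x =
      if x = 2 * j then 2 * j + 1 else if x = 2 * j + 1 then 2 * j else foldPerm f j x := by
  rw [foldPerm, Equiv.Perm.mul_apply, if_pos h, Equiv.swap_apply_def]
  split_ifs <;> first | rfl | exact foldPerm_apply_of_ge f (by omega)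

/-- The new agents are spliced into the arrow leaving `2l`: it now runs through `2j` and `2j+1`
before reaching the old image. -/
theorem foldPerm_succ_of_eq {f : ℕ → ℕ} {j l : ℕ} (h : lastOcc f j (f j) = 2 * l + 1)
    (hl : l < j) (x : ℕ) :
    foldPerm f (j + 1) x =
      if x = 2 * l then 2 * j else if x = 2 * j then 2 * j + 1 else
        if x = 2 * j + 1 then foldPerm f j (2 * l) else foldPerm f j x := by
  rw [foldPerm, Equiv.Perm.mul_apply, if_neg (by omega), Equiv.Perm.mul_apply, h,
    Nat.add_sub_cancel]
  by_cases h1 : x = 2 * l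
  · rw [if_pos h1, h1, Equiv.swap_apply_of_ne_of_ne (a := 2 * j) (by omega) (by omega),
      Equiv.swap_apply_left]
    exact foldPerm_apply_of_ge f le_rfl
  by_cases h2 : x = 2 * j
  · rw [if_neg h1, if_pos h2, h2, Equiv.swap_apply_left,
      Equiv.swap_apply_of_ne_of_ne (by omega) (by omega)]
    exact foldPerm_apply_of_ge f (by omega)
  by_cases h3 : x = 2 * j + 1
  · rw [if_neg h1, if_neg h2, if_pos h3, h3, Equiv.swap_apply_right, Equiv.swap_apply_right]
  · rw [if_neg h1, if_neg h2, if_neg h3, Equiv.swap_apply_of_ne_of_ne h2 h3,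
      Equiv.swap_apply_of_ne_of_ne h1 h2]

/-- The last occurrence is the turning point of its cycle, where the climb along even agents changes
into the return along odd ones. Thus the arrow to be split is always `2l → 2l+1`. -/
theorem foldPerm_lastOcc {f : ℕ → ℕ} {j v l : ℕ} (h : lastOcc f j v = 2 * l + 1) :
    foldPerm f j (2 * l) = 2 * l + 1 := by
  induction j with
  | zero => simp [lastOcc] at h
  | succ j IH =>
    rw [lastOcc] at h
    by_cases hv : v = f j
    · subst hv
      rw [Function.update_self] at h
      obtain rfl : l = j := by omega
      by_cases h0 : lastOcc f l (f l) = 0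
      · rw [foldPerm_succ_of_eq_zero h0, if_pos rfl]
      · obtain ⟨l', hl', h1, -⟩ := exists_of_lastOcc_ne_zero h0
        rw [foldPerm_succ_of_eq h1 hl', if_neg (by omega), if_pos rfl]
    · rw [Function.update_of_ne hv] at h
      obtain ⟨l', hl', h1', h2', -⟩ := exists_of_lastOcc_ne_zero (f := f) (j := j) (v := v) (by omega)
      obtain rfl : l = l' := by omega
      by_cases h0 : lastOcc f j (f j) = 0
      · rw [foldPerm_succ_of_eq_zero h0, if_neg (by omega), if_neg (by omega), IH h]
      · obtain ⟨l', hl', h1, h2, -⟩ := exists_of_lastOcc_ne_zero h0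
        have : l ≠ l' := fun h' => hv (by rw [← h2', h', h2])
        rw [foldPerm_succ_of_eq h1 hl', if_neg (by omega), if_neg (by omega), if_neg (by omega),
          IH h]

theorem foldPerm_succ_of_consec {f : ℕ → ℕ} {j l : ℕ} (h : lastOcc f j (f j) = 2 * l + 1)
    (hl : l < j) (x : ℕ) :
    foldPerm f (j + 1) x =
      if x = 2 * l then 2 * j else if x = 2 * j then 2 * j + 1 else
        if x = 2 * j + 1 then 2 * l + 1 else foldPerm f j x := by
  rw [foldPerm_succ_of_eq h hl, foldPerm_lastOcc h]

theorem foldPerm_symm_succ_of_eq_zero {f : ℕ → ℕ} {j : ℕ} (h : lastOcc f j (f j) = 0) (x : ℕ) :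
    (foldPerm f (j + 1)).symm x =
      if x = 2 * j + 1 then 2 * j else if x = 2 * j then 2 * j + 1 else
        (foldPerm f j).symm x := by
  obtain ⟨y, rfl⟩ := (foldPerm f j).surjective x
  have k1 := foldPerm_apply_of_ge f (j := j) (x := 2 * j) (by omega)
  have k2 := foldPerm_apply_of_ge f (j := j) (x := 2 * j + 1) (by omega)
  have i1 := (foldPerm f j).injective.eq_iff (a := y) (b := 2 * j)
  have i2 := (foldPerm f j).injective.eq_iff (a := y) (b := 2 * j + 1)
  rw [Equiv.symm_apply_eq, foldPerm_succ_of_eq_zero h, Equiv.symm_apply_apply]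
  split_ifs <;> omega

theorem foldPerm_symm_succ_of_consec {f : ℕ → ℕ} {j l : ℕ} (h : lastOcc f j (f j) = 2 * l + 1)
    (hl : l < j) (x : ℕ) :
    (foldPerm f (j + 1)).symm x =
      if x = 2 * j then 2 * l else if x = 2 * j + 1 then 2 * j else
        if x = 2 * l + 1 then 2 * j + 1 else (foldPerm f j).symm x := by
  obtain ⟨y, rfl⟩ := (foldPerm f j).surjective x
  have k1 := foldPerm_apply_of_ge f (j := j) (x := 2 * j) (by omega)
  have k2 := foldPerm_apply_of_ge f (j := j) (x := 2 * j + 1) (by omega)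
  have k3 := foldPerm_lastOcc h
  have i1 := (foldPerm f j).injective.eq_iff (a := y) (b := 2 * j)
  have i2 := (foldPerm f j).injective.eq_iff (a := y) (b := 2 * j + 1)
  have i3 := (foldPerm f j).injective.eq_iff (a := y) (b := 2 * l)
  rw [Equiv.symm_apply_eq, foldPerm_succ_of_consec h hl, Equiv.symm_apply_apply]
  split_ifs <;> omega

theorem foldPerm_lt (f : ℕ → ℕ) {j x : ℕ} (hx : x < 2 * j) : foldPerm f j x < 2 * j := by
  by_contra h
  have h1 := foldPerm_apply_of_ge f (not_lt.1 h)
  have := (foldPerm f j).injective h1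
  omega

theorem foldPerm_symm_lt (f : ℕ → ℕ) {j x : ℕ} (hx : x < 2 * j) :
    (foldPerm f j).symm x < 2 * j := by
  by_contra h
  have h1 := foldPerm_apply_of_ge f (not_lt.1 h)
  rw [Equiv.apply_symm_apply] at h1
  omega

/-- The fold moves every agent within its incidence or to a consecutive occurrence of the same
letter. -/
theorem foldPerm_move (f : ℕ → ℕ) {j x : ℕ} (hx : x < 2 * j) :
    foldPerm f j x ≠ x ∧ (foldPerm f j x / 2 = x / 2 ∨ Consec f (x / 2) (foldPerm f j x / 2) ∨
      Consec f (foldPerm f j x / 2) (x / 2)) := by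
  induction j with
  | zero => omega
  | succ j IH =>
    by_cases h0 : lastOcc f j (f j) = 0
    · rw [foldPerm_succ_of_eq_zero h0]
      split_ifs with h1 h2
      · exact ⟨by omega, Or.inl (by omega)⟩
      · exact ⟨by omega, Or.inl (by omega)⟩
      · exact IH (by omega)
    · obtain ⟨l, hl, h1, h2, h3⟩ := exists_of_lastOcc_ne_zero h0
      have hc : Consec f l j := ⟨hl, h2, h3⟩
      rw [foldPerm_succ_of_consec h1 hl]
      split_ifs with h4 h5 h6
      · refine ⟨by omega, Or.inr (Or.inl ?_)⟩
        rw [h4]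
        simpa using hc
      · exact ⟨by omega, Or.inl (by omega)⟩
      · refine ⟨by omega, Or.inr (Or.inr ?_)⟩
        rw [h6, show (2 * l + 1) / 2 = l by omega, show (2 * j + 1) / 2 = j by omega]
        exact hc
      · exact IH (by omega)

/-- Adding an occurrence only subdivides an old arrow or creates a separate two-cycle. Old cycles
therefore stay connected, and the new agents join the cycle of the previous occurrence. -/
theorem foldPerm_sameCycle (f : ℕ → ℕ) {j x y : ℕ} (hx : x < 2 * j) (hy : y < 2 * j)
    (hxy : f (x / 2) = f (y / 2)) : (foldPerm f j).SameCycle x y := by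
  induction j generalizing x y with
  | zero => omega
  | succ j IH =>
    have step : ∀ z, (foldPerm f (j + 1)).SameCycle z (foldPerm f (j + 1) z) := fun z =>
      ⟨1, by rw [zpow_one]⟩
    have hnew : (foldPerm f (j + 1)).SameCycle (2 * j) (2 * j + 1) := by
      have := step (2 * j)
      by_cases h0 : lastOcc f j (f j) = 0
      · rwa [foldPerm_succ_of_eq_zero h0, if_pos rfl] at this
      · obtain ⟨l, hl, h1, h2, h3⟩ := exists_of_lastOcc_ne_zero h0
        rwa [foldPerm_succ_of_consec h1 hl, if_neg (by omega), if_pos rfl] at this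
    have hold : ∀ z < 2 * j, (foldPerm f (j + 1)).SameCycle z (foldPerm f j z) := by
      intro z hz
      have hz' := step z
      by_cases h0 : lastOcc f j (f j) = 0
      · rwa [foldPerm_succ_of_eq_zero h0, if_neg (by omega), if_neg (by omega)] at hz'
      · obtain ⟨l, hl, h1, h2, h3⟩ := exists_of_lastOcc_ne_zero h0
        -- This is the only old arrow that disappears; it is replaced by the path through `2j` and
        -- `2j+1`.
        by_cases hzl : z = 2 * l
        · have h4 := step (2 * j + 1)
          rw [foldPerm_succ_of_consec h1 hl, if_neg (by omega), if_neg (by omega), if_pos rfl] at h4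
          rw [foldPerm_succ_of_consec h1 hl, if_pos hzl] at hz'
          rw [hzl] at hz' ⊢
          rw [foldPerm_lastOcc h1]
          exact (hz'.trans hnew).trans h4
        · rwa [foldPerm_succ_of_consec h1 hl, if_neg hzl, if_neg (by omega),
            if_neg (by omega)] at hz'
    have hold' : ∀ z w, z < 2 * j → (foldPerm f j).SameCycle z w →
        (foldPerm f (j + 1)).SameCycle z w := by
      rintro z w hz ⟨i, rfl⟩
      suffices h : ((foldPerm f j ^ i) z < 2 * j) ∧
          (foldPerm f (j + 1)).SameCycle z ((foldPerm f j ^ i) z) from h.2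
      induction i with
      | zero => exact ⟨hz, Equiv.Perm.SameCycle.refl _ _⟩
      | succ i IHi =>
        rw [add_comm, zpow_add, zpow_one, Equiv.Perm.mul_apply]
        exact ⟨foldPerm_lt f IHi.1, IHi.2.trans (hold _ IHi.1)⟩
      | pred i IHi =>
        rw [sub_eq_add_neg, add_comm, zpow_add, zpow_neg_one, Equiv.Perm.mul_apply]
        have h1 := foldPerm_symm_lt f IHi.1
        refine ⟨h1, IHi.2.trans ?_⟩
        have := hold _ h1
        rw [Equiv.apply_symm_apply] at this
        exact this.symm
    have hnew' : ∀ z < 2 * j, f (z / 2) = f j → (foldPerm f (j + 1)).SameCycle z (2 * j) := by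
      intro z hz hzj
      by_cases h0 : lastOcc f j (f j) = 0
      · exact absurd hzj (lastOcc_eq_zero h0 (z / 2) (by omega))
      · obtain ⟨l, hl, h1, h2, h3⟩ := exists_of_lastOcc_ne_zero h0
        have h4 := step (2 * l)
        rw [foldPerm_succ_of_consec h1 hl, if_pos rfl] at h4
        refine (hold' z (2 * l) hz (IH hz (by omega) ?_)).trans h4
        rw [hzj, Nat.mul_div_cancel_left l (by omega), h2]
    have htop : ∀ z < 2 * (j + 1), f (z / 2) = f j →
        (foldPerm f (j + 1)).SameCycle z (2 * j) := by
      intro z hz hzj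
      by_cases h1 : z < 2 * j
      · exact hnew' z h1 hzj
      · obtain rfl | rfl : z = 2 * j ∨ z = 2 * j + 1 := by omega
        · exact Equiv.Perm.SameCycle.refl _ _
        · exact hnew.symm
    by_cases h1 : f (x / 2) = f j
    · exact (htop x hx h1).trans (htop y hy (hxy ▸ h1)).symm
    · have h2 : f (y / 2) ≠ f j := hxy ▸ h1
      have h3 : x / 2 ≠ j := fun h => h1 (by rw [h])
      have h4 : y / 2 ≠ j := fun h => h2 (by rw [h])
      exact hold' x y (by omega) (IH (by omega) (by omega) hxy)

/-- The fold as a permutation of the agents. -/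
def foldPermFin (f : ℕ → ℕ) (N : ℕ) : Equiv.Perm (Fin (2 * N)) where
  toFun x := ⟨foldPerm f N x, foldPerm_lt f x.2⟩
  invFun x := ⟨(foldPerm f N).symm x, foldPerm_symm_lt f x.2⟩
  left_inv x := by simp
  right_inv x := by simp

theorem foldPermFin_sameCycle (f : ℕ → ℕ) {N : ℕ} (x y : Fin (2 * N))
    (h : f (x / 2) = f (y / 2)) : (foldPermFin f N).SameCycle x y := by
  obtain ⟨i, hi⟩ := foldPerm_sameCycle f x.2 y.2 h
  refine ⟨i, Fin.ext ?_⟩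
  rw [← hi]
  clear hi
  induction i with
  | zero => rfl
  | succ i IH =>
    rw [add_comm, zpow_add, zpow_one, zpow_add, zpow_one, Equiv.Perm.mul_apply,
      Equiv.Perm.mul_apply, ← IH]
    rfl
  | pred i IH =>
    rw [sub_eq_add_neg, add_comm, zpow_add, zpow_neg_one, zpow_add, zpow_neg_one,
      Equiv.Perm.mul_apply, Equiv.Perm.mul_apply, ← IH]
    rfl

/-! ### Concatenated lists -/

/-- The position in the concatenation of `L` at which list number `i` starts. -/
def bagStart {α : Type*} (L : List (List α)) (i : ℕ) : ℕ := ((L.map List.length).take i).sum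

/-- One plus the number of the list of `L` that covers position `q` of the concatenation. -/
def bagNumber {α : Type*} (L : List (List α)) (q : ℕ) : ℕ :=
  ((Finset.range L.length).filter fun i => bagStart L i ≤ q).card

section Concatenation

variable {α : Type*} (L : List (List α))

theorem bagStart_succ {i : ℕ} (hi : i < L.length) :
    bagStart L (i + 1) = bagStart L i + L[i].length := by
  rw [bagStart, bagStart, List.sum_take_succ _ _ (by simpa using hi), List.getElem_map]

theorem bagStart_mono : Monotone (bagStart L) := by
  refine monotone_nat_of_le_succ fun i => ?_
  rcases lt_or_ge i L.length with h | h
  · rw [bagStart_succ L h]; omega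
  · rw [bagStart, bagStart, List.take_of_length_le (by simpa using h),
      List.take_of_length_le (by simp; omega)]

theorem bagStart_length : bagStart L L.length = L.flatten.length := by
  rw [bagStart, List.take_of_length_le (by simp), List.length_flatten]

theorem getElem?_flatten_bagStart {i j : ℕ} (hi : i < L.length) (hj : j < L[i].length) :
    L.flatten[bagStart L i + j]? = some L[i][j] := by
  have h := L.drop_take_succ_flatten_eq_getElem i hi
  have h1 := congrArg (fun l : List α => l[j]?) h
  simp only [List.getElem?_drop, List.getElem?_take] at h1
  rw [if_pos] at h1
  · rw [bagStart, h1, List.getElem?_eq_getElem hj]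
  · have := bagStart_succ L hi
    unfold bagStart at this
    omega

theorem bagNumber_eq {i q : ℕ} (hi : i < L.length) (h1 : bagStart L i ≤ q)
    (h2 : q < bagStart L (i + 1)) : bagNumber L q = i + 1 := by
  have : ((Finset.range L.length).filter fun i => bagStart L i ≤ q) = Finset.range (i + 1) := by
    ext j
    simp only [Finset.mem_filter, Finset.mem_range]
    constructor
    · rintro ⟨-, h3⟩
      by_contra h4
      have := bagStart_mono L (not_lt.1 h4)
      omega
    · intro h3
      have := bagStart_mono L (Nat.lt_succ_iff.1 h3)
      omega
  rw [bagNumber, this, Finset.card_range]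

theorem bagNumber_mono : Monotone (bagNumber L) := fun q q' h =>
  Finset.card_le_card fun i hi => by
    simp only [Finset.mem_filter] at hi ⊢
    exact ⟨hi.1, hi.2.trans h⟩

theorem exists_bag_of_lt {q : ℕ} (hq : q < L.flatten.length) :
    ∃ i < L.length, bagStart L i ≤ q ∧ q < bagStart L (i + 1) := by
  rw [← bagStart_length] at hq
  generalize L.length = m at hq
  induction m with
  | zero => simp [bagStart] at hq
  | succ m IH =>
    rcases lt_or_ge q (bagStart L m) with h | h
    · obtain ⟨i, hi, h1⟩ := IH h
      exact ⟨i, by omega, h1⟩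
    · exact ⟨m, by omega, h, hq⟩

theorem bagNumber_spec {q : ℕ} (hq : q < L.flatten.length) :
    ∃ i, ∃ hi : i < L.length, bagNumber L q = i + 1 ∧ bagStart L i ≤ q ∧
      q < bagStart L i + L[i].length ∧ L.flatten[q] ∈ L[i] := by
  obtain ⟨i, hi, h1, h2⟩ := exists_bag_of_lt L hq
  have h3 := bagStart_succ L hi
  refine ⟨i, hi, bagNumber_eq L hi h1 h2, h1, by omega, ?_⟩
  have h4 := getElem?_flatten_bagStart L hi (j := q - bagStart L i) (by omega)
  rw [Nat.add_sub_cancel' h1, List.getElem?_eq_getElem hq, Option.some_inj] at h4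
  rw [h4]
  exact List.getElem_mem _

theorem exists_position {i : ℕ} (hi : i < L.length) {a : α} (ha : a ∈ L[i]) :
    ∃ q, ∃ hq : q < L.flatten.length, L.flatten[q] = a ∧ bagNumber L q = i + 1 := by
  obtain ⟨j, hj, rfl⟩ := List.getElem_of_mem ha
  have h1 := getElem?_flatten_bagStart L hi hj
  obtain ⟨h2, h3⟩ := List.getElem?_eq_some_iff.1 h1
  refine ⟨_, h2, h3, bagNumber_eq L hi (by omega) ?_⟩
  rw [bagStart_succ L hi]
  omega

end Concatenation

/-! ### The frame of a path decomposition -/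

section Decomposition

variable {V : Type*} {p r k : ℕ} (e : V ≃ Fin p) (bag : Fin r → List V)

/-- The bags, as lists of numbers. -/
def numberedBags : List (List ℕ) := List.ofFn fun i => (bag i).map fun v => (e v : ℕ)

/-- The number of the vertex at position `q` of the concatenated bags. -/
def bagWord (q : ℕ) : ℕ := (numberedBags e bag).flatten.getD q 0

variable {bag}

theorem length_numberedBags : (numberedBags e bag).length = r := by simp [numberedBags]

theorem getElem_numberedBags {i : ℕ} (hi : i < (numberedBags e bag).length) :
    (numberedBags e bag)[i] = (bag ⟨i, by simpa [numberedBags] using hi⟩).map fun v => (e v : ℕ) := by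
  simp [numberedBags]

variable [DecidableEq V] {X : Fin r → Finset V}
  (hbag : ∀ i, (bag i).Nodup ∧ (bag i).toFinset = X i)
include hbag

theorem bagWord_spec {q : ℕ} (hq : q < (numberedBags e bag).flatten.length) :
    ∃ i : Fin r, bagNumber (numberedBags e bag) q = i + 1 ∧
      bagStart (numberedBags e bag) i ≤ q ∧
      q < bagStart (numberedBags e bag) i + (X i).card ∧ ∃ v ∈ X i, bagWord e bag q = e v := by
  obtain ⟨i, hi, h1, h2, h3, h4⟩ := bagNumber_spec _ hq
  rw [getElem_numberedBags] at h3 h4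
  rw [length_numberedBags] at hi
  refine ⟨⟨i, hi⟩, h1, h2, ?_, ?_⟩
  · rw [← (hbag _).2, List.toFinset_card_of_nodup (hbag _).1]
    simpa using h3
  · obtain ⟨v, hv, h5⟩ := List.mem_map.1 h4
    refine ⟨v, ?_, ?_⟩
    · rw [← (hbag _).2, List.mem_toFinset]
      exact hv
    · rw [bagWord, List.getD_eq_getElem _ _ hq, h5]

theorem bagWord_lt {q : ℕ} (hq : q < (numberedBags e bag).flatten.length) :
    bagWord e bag q < p := by
  obtain ⟨i, -, -, -, v, -, h⟩ := bagWord_spec e hbag hq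
  rw [h]
  exact (e v).2

theorem exists_bagWord {i : Fin r} {v : V} (hv : v ∈ X i) :
    ∃ q < (numberedBags e bag).flatten.length, bagWord e bag q = e v ∧
      bagNumber (numberedBags e bag) q = i + 1 := by
  have hi : (i : ℕ) < (numberedBags e bag).length := by rw [length_numberedBags]; exact i.2
  rw [← (hbag i).2, List.mem_toFinset] at hv
  obtain ⟨q, hq, h1, h2⟩ := exists_position (numberedBags e bag) hi (a := (e v : ℕ)) (by
    rw [getElem_numberedBags]
    exact List.mem_map.2 ⟨v, hv, rfl⟩)
  exact ⟨q, hq, by rw [bagWord, List.getD_eq_getElem _ _ hq, h1], h2⟩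

/-- If two occurrences of a vertex skipped a bag, the interval property would put the vertex into
the skipped bag too, giving an occurrence strictly between them. -/
theorem bagNumber_le_of_consec {G : SimpleGraph V} (hX : IsPathDecomposition G X) {a b : ℕ}
    (hb : b < (numberedBags e bag).flatten.length) (h : Consec (bagWord e bag) a b) :
    bagNumber (numberedBags e bag) b ≤ bagNumber (numberedBags e bag) a + 1 := by
  obtain ⟨i, hi, -, -, v, hv, hva⟩ := bagWord_spec e hbag (h.1.trans hb)
  obtain ⟨j, hj, -, -, w, hw, hwb⟩ := bagWord_spec e hbag hb
  obtain rfl : v = w := e.injective (Fin.ext (by rw [← hva, ← hwb, h.2.1]))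
  by_contra! hlt
  have hir : (i : ℕ) + 1 < r := by have := j.2; omega
  have hmid := hX.2.2 i ⟨i + 1, hir⟩ j (Fin.mk_le_mk.2 (by omega)) (Fin.mk_le_mk.2 (by omega)) v hv hw
  obtain ⟨q, hq, h1, h2⟩ := exists_bagWord e hbag hmid
  simp only at h2
  refine h.2.2 q ?_ ?_ (h1.trans hwb.symm)
  · by_contra h3
    have := bagNumber_mono (numberedBags e bag) (not_lt.1 h3)
    omega
  · by_contra h3
    have := bagNumber_mono (numberedBags e bag) (not_lt.1 h3)
    omega

theorem flatten_length_le (hk : ∀ i, (X i).card ≤ k + 1) :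
    (numberedBags e bag).flatten.length ≤ r * (k + 1) := by
  rw [List.length_flatten]
  have := List.sum_le_card_nsmul ((numberedBags e bag).map List.length) (k + 1) (by
    intro x hx
    simp only [numberedBags, List.map_ofFn, List.mem_ofFn, Function.comp, List.length_map] at hx
    obtain ⟨i, rfl⟩ := hx
    rw [← List.toFinset_card_of_nodup (hbag i).1, (hbag i).2]
    exact hk i)
  simpa [length_numberedBags] using this

variable [PartialOrder V]

/-- The rotation frame of a path decomposition of the Hasse diagram. -/
def decompositionFrame (hX : IsPathDecomposition (SimpleGraph.hasse V) X) :
    RotationFrame V (2 * (numberedBags e bag).flatten.length) where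
  own x := e.symm ⟨bagWord e bag (x / 2), bagWord_lt e hbag (by omega)⟩
  bg x := bagNumber (numberedBags e bag) (x / 2)
  σ := foldPermFin (bagWord e bag) _
  bg_mono x y hxy := bagNumber_mono _ (Nat.div_le_div_right hxy)
  bg_σ_le x := by
    rcases (foldPerm_move (bagWord e bag) x.2).2 with h | h | h
    · exact (congrArg _ h).trans_le (Nat.le_succ _)
    · refine bagNumber_le_of_consec e hbag hX ?_ h
      have := foldPerm_lt (bagWord e bag) x.2
      omega
    · exact (bagNumber_mono _ h.1.le).trans (Nat.le_succ _)
  le_bg_σ x := by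
    rcases (foldPerm_move (bagWord e bag) x.2).2 with h | h | h
    · exact (congrArg _ h.symm).trans_le (Nat.le_succ _)
    · exact (bagNumber_mono _ h.1.le).trans (Nat.le_succ _)
    · exact bagNumber_le_of_consec e hbag hX (by omega) h
  own_σ x := by
    congr 2
    rcases (foldPerm_move (bagWord e bag) x.2).2 with h | h | h
    · exact congrArg _ h
    · exact h.2.1.symm
    · exact h.2.1
  sameCycle x y h := by
    refine foldPermFin_sameCycle _ x y ?_
    simpa using h
  own_surjective v := by
    obtain ⟨i, hi⟩ := hX.1 v
    obtain ⟨q, hq, h1, -⟩ := exists_bagWord e hbag hi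
    refine ⟨⟨2 * q, by omega⟩, ?_⟩
    rw [Equiv.symm_apply_eq]
    ext
    simp [h1]
  σ_ne x h := (foldPerm_move (bagWord e bag) x.2).1 (congrArg Fin.val h)
  exists_of_covBy u v huv := by
    obtain ⟨i, hu, hv⟩ := hX.2.1 u v (Or.inl huv)
    obtain ⟨q, hq, h1, h2⟩ := exists_bagWord e hbag hu
    obtain ⟨q', hq', h1', h2'⟩ := exists_bagWord e hbag hv
    refine ⟨⟨2 * q, by omega⟩, ⟨2 * q', by omega⟩, ?_, ?_, ?_⟩
    · simp [h2, h2']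
    · rw [Equiv.symm_apply_eq]
      ext
      simp [h1]
    · rw [Equiv.symm_apply_eq]
      ext
      simp [h1']

/-- The agents of one bag are an interval of numbers, two for each member. Bag numbers start at one,
so group zero is empty. -/
theorem card_bg_eq_le (hX : IsPathDecomposition (SimpleGraph.hasse V) X)
    (hk : ∀ i, (X i).card ≤ k + 1) (i : ℕ) :
    (Finset.univ.filter fun x => (decompositionFrame e hbag hX).bg x = i).card ≤ 2 * (k + 1) := by
  rcases i with _ | i
  · rw [Finset.filter_false_of_mem]
    · simp
    · intro x _ hx
      obtain ⟨j, hj, -⟩ := bagWord_spec e hbag (q := x / 2) (by omega)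
      have := hj.symm.trans hx
      omega
  · by_cases hi : i < r
    · have := Finset.card_le_card_of_injOn (s := Finset.univ.filter fun x =>
          (decompositionFrame e hbag hX).bg x = i + 1)
        (t := Finset.Ico (2 * bagStart (numberedBags e bag) i)
          (2 * bagStart (numberedBags e bag) i + 2 * (X ⟨i, hi⟩).card)) Fin.val ?_
        Fin.val_injective.injOn
      · rw [Nat.card_Ico] at this
        have := hk ⟨i, hi⟩
        omega
      · intro x hx
        simp only [Finset.coe_filter, Finset.mem_univ, true_and, Set.mem_ofPred_eq] at hx
        obtain ⟨j, hj, h1, h2, -⟩ := bagWord_spec e hbag (q := x / 2) (by omega)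
        have := hj.symm.trans hx
        obtain rfl : j = ⟨i, hi⟩ := Fin.ext (by simpa using this)
        simp only [Finset.coe_Ico, Set.mem_Ico] at *
        omega
    · rw [Finset.filter_false_of_mem]
      · simp
      · intro x _ hx
        obtain ⟨j, hj, -⟩ := bagWord_spec e hbag (q := x / 2) (by omega)
        have := hj.symm.trans hx
        omega

end Decomposition

/-- A nice path decomposition of a graph with `p` vertices has at most `2 p + 1` bags. -/
theorem IsNicePathDecomposition.length_le {V : Type*} [DecidableEq V] [Fintype V] {r : ℕ}
    {G : SimpleGraph V} {X : Fin r → Finset V} (h : IsNicePathDecomposition G X) :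
    r ≤ 2 * Fintype.card V + 1 := by
  obtain ⟨⟨-, -, hint⟩, -, -, -, hstep⟩ := h
  have hv : ∀ i : Fin (r - 1), ∃ v, symmDiff (X ⟨i, by omega⟩) (X ⟨i + 1, by omega⟩) = {v} :=
    fun i => Finset.card_eq_one.1 (hstep _ _ rfl)
  choose v hv using hv
  have hmem : ∀ i : Fin (r - 1), v i ∈ X ⟨i, by omega⟩ ↔ v i ∉ X ⟨i + 1, by omega⟩ := fun i => by
    have : v i ∈ symmDiff (X ⟨i, by omega⟩) (X ⟨i + 1, by omega⟩) := by
      rw [hv i]; exact Finset.mem_singleton_self _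
    rw [Finset.mem_symmDiff] at this
    tauto
  -- Each step is encoded by the vertex that changes and by whether it leaves or enters.
  let f : Fin (r - 1) → V × Bool := fun i => (v i, decide (v i ∈ X ⟨i, by omega⟩))
  have hlt : ∀ i j : Fin (r - 1), i < j → f i ≠ f j := by
    intro i j hij heq
    simp only [f, Prod.mk.injEq, decide_eq_decide] at heq
    obtain ⟨h1, h2⟩ := heq
    have hi := hmem i
    have hj := hmem j
    rw [h1] at hi h2
    have hij' : (i : ℕ) < j := hij
    -- A repeated removal or introduction would make the bags containing the vertex fail to be an
    -- interval: in the first case it vanishes after `i` and is back at `j`, in the second it is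
    -- absent at `j` but present before and after.
    by_cases hm : v j ∈ X ⟨i, by omega⟩
    · exact hi.1 hm (hint ⟨i, by omega⟩ ⟨i + 1, by omega⟩ ⟨j, by omega⟩ (Fin.mk_le_mk.2 (by omega))
        (Fin.mk_le_mk.2 (by omega)) _ hm (h2.1 hm))
    · have hm1 : v j ∈ X ⟨i + 1, by omega⟩ := by tauto
      have hm2 : v j ∈ X ⟨j + 1, by omega⟩ := by tauto
      exact (fun h => hm (h2.2 h)) (hint ⟨i + 1, by omega⟩ ⟨j, by omega⟩ ⟨j + 1, by omega⟩
        (Fin.mk_le_mk.2 (by omega)) (Fin.mk_le_mk.2 (by omega)) _ hm1 hm2)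
  have hinj : Function.Injective f := fun i j hf => by
    rcases lt_trichotomy i j with h1 | h1 | h1
    · exact absurd hf (hlt i j h1)
    · exact h1
    · exact absurd hf.symm (hlt j i h1)
  have := Fintype.card_le_of_injective f hinj
  simp only [Fintype.card_fin, Fintype.card_prod, Fintype.card_bool] at this
  omega

/-! ### Program logic for the random access machine -/

namespace RAM

/-- Started in `s`, the program `c` halts after at most `T` steps in a state with property `Q`. -/
def Runs (B : ℕ) (c : Prog) (s : State) (T : ℕ) (Q : State → Prop) : Prop :=
  ∃ s' t, t ≤ T ∧ Exec B c s s' t ∧ Q s'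

variable {B : ℕ} {s : State} {Q : State → Prop}

theorem Runs.mono {c : Prog} {T T' : ℕ} {Q' : State → Prop} (h : Runs B c s T Q) (hT : T ≤ T')
    (hQ : ∀ s', Q s' → Q' s') : Runs B c s T' Q' := by
  obtain ⟨s', t, ht, he, hq⟩ := h
  exact ⟨s', t, ht.trans hT, he, hQ s' hq⟩

theorem Runs.seq {c d : Prog} {T T' : ℕ} (h : Runs B c s T fun s' => Runs B d s' T' Q) :
    Runs B (.seq c d) s (T + T') Q := by
  obtain ⟨s', t, ht, he, s'', t', ht', he', hq⟩ := h
  exact ⟨s'', t + t', by omega, .seq _ _ _ _ _ _ _ he he', hq⟩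

theorem Runs.ite {x y : ℕ} {c d : Prog} {T : ℕ} (h1 : s.reg x < s.reg y → Runs B c s T Q)
    (h2 : ¬ s.reg x < s.reg y → Runs B d s T Q) : Runs B (.ite x y c d) s (1 + T) Q := by
  by_cases h : s.reg x < s.reg y
  · obtain ⟨s', t, ht, he, hq⟩ := h1 h
    exact ⟨s', 1 + t, by omega, .ite_true _ _ _ _ _ _ _ h he, hq⟩
  · obtain ⟨s', t, ht, he, hq⟩ := h2 h
    exact ⟨s', 1 + t, by omega, .ite_false _ _ _ _ _ _ _ h he, hq⟩

/-- A loop that runs through the stages `0, …, n` of an invariant. -/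
theorem Runs.loop {x y n T : ℕ} {c : Prog} (Inv : ℕ → State → Prop) (h0 : Inv 0 s)
    (hlt : ∀ j < n, ∀ s, Inv j s → s.reg x < s.reg y)
    (hexit : ∀ s, Inv n s → ¬ s.reg x < s.reg y)
    (hstep : ∀ j < n, ∀ s, Inv j s → Runs B c s T (Inv (j + 1)))
    (hQ : ∀ s, Inv n s → Q s) : Runs B (.loop x y c) s (n * (T + 1) + 1) Q := by
  suffices h : ∀ m j s, j + m = n → Inv j s → Runs B (.loop x y c) s (m * (T + 1) + 1) Q from
    h n 0 s (zero_add n) h0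
  intro m
  induction m with
  | zero =>
    rintro j s rfl hj
    exact ⟨s, 1, by omega, .loop_false _ _ _ _ (hexit s hj), hQ s hj⟩
  | succ m IH =>
    intro j s hjm hj
    obtain ⟨s', t, ht, he, hq⟩ := hstep j (by omega) s hj
    obtain ⟨s'', t', ht', he', hq'⟩ := IH (j + 1) s' (by omega) hq
    refine ⟨s'', 1 + t + t', ?_, .loop_true _ _ _ _ _ _ _ _ (hlt j (by omega) s hj) he he', hq'⟩
    rw [Nat.succ_mul]
    omega

/-- Weakest precondition of a program without loops. -/
def wp (B : ℕ) : Prog → (State → Prop) → State → Prop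
  | .skip, Q, s => Q s
  | .const x v, Q, s => v ≤ B ∧ Q (s.setReg x v)
  | .copy x y, Q, s => Q (s.setReg x (s.reg y))
  | .arith o x y z, Q, s =>
    o.eval (s.reg y) (s.reg z) ≤ B ∧ Q (s.setReg x (o.eval (s.reg y) (s.reg z)))
  | .load x a y, Q, s => Q (s.setReg x (s.arr a (s.reg y)))
  | .store a x y, Q, s => Q (s.setArr a (s.reg x) (s.reg y))
  | .seq c d, Q, s => wp B c (wp B d Q) s
  | .ite x y c d, Q, s =>
    (s.reg x < s.reg y → wp B c Q s) ∧ (¬ s.reg x < s.reg y → wp B d Q s)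
  | .loop _ _ _, _, _ => False

/-- Bound on the number of steps of a program without loops. -/
def cost : Prog → ℕ
  | .seq c d => cost c + cost d
  | .ite _ _ c d => 1 + max (cost c) (cost d)
  | _ => 1

theorem runs_of_wp {c : Prog} (h : wp B c Q s) : Runs B c s (cost c) Q := by
  induction c generalizing s Q with
  | skip => exact ⟨_, _, le_rfl, .skip _, h⟩
  | const x v => exact ⟨_, _, le_rfl, .const _ _ _ h.1, h.2⟩
  | copy x y => exact ⟨_, _, le_rfl, .copy _ _ _, h⟩
  | arith o x y z => exact ⟨_, _, le_rfl, .arith _ _ _ _ _ h.1, h.2⟩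
  | load x a y => exact ⟨_, _, le_rfl, .load _ _ _ _, h⟩
  | store a x y => exact ⟨_, _, le_rfl, .store _ _ _ _, h⟩
  | seq c d IHc IHd => exact Runs.seq ((IHc h).mono le_rfl fun s' => IHd)
  | ite x y c d IHc IHd =>
    exact Runs.ite (fun h' => (IHc (h.1 h')).mono (le_max_left _ _) fun _ => id)
      fun h' => (IHd (h.2 h')).mono (le_max_right _ _) fun _ => id
  | loop x y c => exact h.elim

/-- The programs of a list, one after the other. -/
def seqs : List Prog → Prog
  | [] => .skip
  | c :: l => .seq c (seqs l)

@[simp] theorem State.setReg_reg (s : State) (x v : ℕ) :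
    (s.setReg x v).reg = Function.update s.reg x v := rfl

@[simp] theorem State.setReg_arr (s : State) (x v : ℕ) : (s.setReg x v).arr = s.arr := rfl

@[simp] theorem State.setArr_reg (s : State) (a i v : ℕ) : (s.setArr a i v).reg = s.reg := rfl

@[simp] theorem State.setArr_arr (s : State) (a i v : ℕ) :
    (s.setArr a i v).arr = Function.update s.arr a (Function.update (s.arr a) i v) := rfl

/-! ### The program -/

/-- Enter one edge into the adjacency matrix and its transpose. -/
def edgeBody : Prog := seqs [.load 22 0 4, .load 23 1 4, .arith .mul 24 22 0,
  .arith .add 24 24 23, .store 10 24 3, .arith .mul 24 23 0, .arith .add 24 24 22,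
  .store 11 24 3, .arith .add 4 4 3]

/-- Compute the adjacency matrix and its transpose. -/
def edgeCode : Prog := seqs [.const 3 1, .loop 4 1 edgeBody]

/-- After `j` edges. -/
def EdgeInv (A : ℕ → ℕ → ℕ) (p m r j : ℕ) (s : State) : Prop :=
  s.reg 0 = p ∧ s.reg 1 = m ∧ s.reg 2 = r ∧ s.reg 3 = 1 ∧ s.reg 4 = j ∧
    (∀ a ≠ 10, a ≠ 11 → s.arr a = A a) ∧
    (∀ z, 0 < s.arr 10 z ↔ ∃ t < j, A 0 t * p + A 1 t = z) ∧
    (∀ z, 0 < s.arr 11 z ↔ ∃ t < j, A 1 t * p + A 0 t = z)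

theorem pos_mark_iff {f w : ℕ → ℕ} {j z : ℕ} (h : 0 < f z ↔ ∃ t < j, w t = z) :
    (0 < if z = w j then 1 else f z) ↔ ∃ t ≤ j, w t = z := by
  split_ifs with hz
  · exact iff_of_true one_pos ⟨j, le_rfl, hz.symm⟩
  · rw [h]
    refine exists_congr fun t => and_congr_left fun ht => ⟨le_of_lt, fun htj => ?_⟩
    refine htj.lt_of_ne fun h' => hz ?_
    rw [← ht, h']

theorem edgeBody_runs {A : ℕ → ℕ → ℕ} {p m r j : ℕ} (hB : m ≤ B) (hj : j < m)
    (hA : A 0 j * p + A 1 j ≤ B ∧ A 1 j * p + A 0 j ≤ B) (h : EdgeInv A p m r j s) :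
    Runs B edgeBody s 10 (EdgeInv A p m r (j + 1)) := by
  obtain ⟨h0, h1, h2, h3, h4, h5, h6, h7⟩ := h
  refine (runs_of_wp (c := edgeBody) ?_).mono (by decide) fun _ h => h
  simp [edgeBody, seqs, wp, Op.eval, EdgeInv, h0, h1, h2, h3, h4, h5, Function.update_apply]
  refine ⟨by omega, by omega, by omega, by omega, by omega, fun a h10 h11 => ?_,
    fun z => pos_mark_iff (w := fun t => A 0 t * p + A 1 t) (h6 z),
    fun z => pos_mark_iff (w := fun t => A 1 t * p + A 0 t) (h7 z)⟩
  rw [if_neg h11, if_neg h10, h5 a h10 h11]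

theorem edgeCode_runs {A : ℕ → ℕ → ℕ} {p m r : ℕ} (hB : m ≤ B) (hB1 : 1 ≤ B)
    (hA : ∀ j < m, A 0 j * p + A 1 j ≤ B ∧ A 1 j * p + A 0 j ≤ B)
    (h0 : s.reg 0 = p) (h1 : s.reg 1 = m) (h2 : s.reg 2 = r) (h4 : s.reg 4 = 0)
    (h5 : s.arr = A) (h10 : A 10 = 0) (h11 : A 11 = 0) :
    Runs B edgeCode s (1 + (m * 11 + 1 + 1)) (EdgeInv A p m r m) := by
  refine Runs.seq (T := 1) ((runs_of_wp (c := .const 3 1) (Q := fun s' => _) ⟨hB1, ?_⟩))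
  refine Runs.seq (T := m * 11 + 1) (Runs.loop (T := 10) (EdgeInv A p m r) ?_ ?_ ?_ ?_ ?_)
  · simp [EdgeInv, h0, h1, h2, h4, h5, h10, h11]
  · rintro j hj s ⟨-, g1, -, -, g4, -⟩
    omega
  · rintro s ⟨-, g1, -, -, g4, -⟩
    omega
  · exact fun j hj s hs => edgeBody_runs hB hj (hA j hj) hs
  · exact fun s hs => runs_of_wp (c := .skip) hs

/-- Process one incidence: its two agents are inserted into the cycle of its vertex. -/
def incidenceBody : Prog := seqs [.load 22 3 5, .arith .add 23 6 3, .store 12 6 22,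
  .store 12 23 22, .store 6 6 4, .store 6 23 4, .store 13 6 6, .store 13 23 23, .load 24 7 22,
  .store 8 6 23, .store 9 23 6,
  .ite 11 24
    (seqs [.arith .sub 25 24 3, .store 8 25 6, .store 8 23 24, .store 9 6 25, .store 9 24 23])
    (seqs [.store 8 23 6, .store 9 6 23]),
  .store 7 22 23, .arith .add 5 5 3, .arith .add 6 23 3]

/-- Process one bag. -/
def bagBody : Prog := seqs [.arith .add 4 4 3, .load 7 2 4, .loop 5 7 incidenceBody]

/-- Process all bags. -/
def bagCode : Prog :=
  seqs [.const 4 0, .const 5 0, .const 6 0, .const 11 0, .loop 4 2 bagBody]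

/-- After `j` incidences. -/
def WordInv (A : ℕ → ℕ → ℕ) (g : ℕ → ℕ) (p r j : ℕ) (s : State) : Prop :=
  s.reg 0 = p ∧ s.reg 2 = r ∧ s.reg 3 = 1 ∧ s.reg 5 = j ∧ s.reg 6 = 2 * j ∧ s.reg 11 = 0 ∧
    s.arr 2 = A 2 ∧ s.arr 3 = A 3 ∧ s.arr 10 = A 10 ∧ s.arr 11 = A 11 ∧
    s.arr 7 = lastOcc (A 3) j ∧ ∀ x < 2 * j, s.arr 6 x = g (x / 2) ∧
      s.arr 12 x = A 3 (x / 2) ∧ s.arr 13 x = x ∧ s.arr 8 x = foldPerm (A 3) j x ∧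
      s.arr 9 x = (foldPerm (A 3) j).symm x

/-- The branch follows the recursion of the fold. The stored value `2l+1` is itself the odd agent of
the previous occurrence, one less is the even agent, and the initial memory value zero means that
there is none. -/
theorem incidenceBody_runs {A : ℕ → ℕ → ℕ} {g : ℕ → ℕ} {p r j i e : ℕ} (hB : 2 * j + 2 ≤ B)
    (hi : g j = i) (h4 : s.reg 4 = i) (h7 : s.reg 7 = e) (h : WordInv A g p r j s) :
    Runs B incidenceBody s 24 fun s' =>
      (s'.reg 4 = i ∧ s'.reg 7 = e) ∧ WordInv A g p r (j + 1) s' := by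
  obtain ⟨h0, h2, h3, h5, h6, h11, a2, a3, a10, a11, a7, hx⟩ := h
  refine (runs_of_wp (c := incidenceBody) ?_).mono (by decide) fun _ h => h
  have hcase : ∀ x < 2 * (j + 1), x = 2 * j ∨ x = 2 * j + 1 ∨ x < 2 * j := fun x hx => by omega
  have hdiv : 2 * j / 2 = j := by omega
  have hdiv' : (2 * j + 1) / 2 = j := by omega
  by_cases hL : lastOcc (A 3) j (A 3 j) = 0
  · simp [incidenceBody, seqs, wp, Op.eval, WordInv, h0, h2, h3, h4, h5, h6, h7, h11, a2, a3, a10,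
      a11, a7, hL, Function.update_apply]
    refine ⟨by omega, by omega, by omega, by omega, rfl, fun x hxj => ?_⟩
    rw [foldPerm_succ_of_eq_zero hL, foldPerm_symm_succ_of_eq_zero hL]
    rcases hcase x hxj with rfl | rfl | h
    · simp [hi]
    · simp [hi, hdiv']
    · obtain ⟨b1, b2, b3, b4, b5⟩ := hx x h
      have c1 : x ≠ 2 * j := by omega
      have c2 : x ≠ 2 * j + 1 := by omega
      simp [b1, b2, b3, b4, b5, c1, c2]
  · obtain ⟨l, hl, e1, -⟩ := exists_of_lastOcc_ne_zero hL
    simp [incidenceBody, seqs, wp, Op.eval, WordInv, h0, h2, h3, h4, h5, h6, h7, h11, a2, a3, a10,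
      a11, a7, e1, Function.update_apply]
    refine ⟨by omega, by omega, by omega, by omega, by omega, rfl, fun x hxj => ?_⟩
    rw [foldPerm_succ_of_consec e1 hl, foldPerm_symm_succ_of_consec e1 hl]
    have d1 : j ≠ l := by omega
    have d2 : 2 * j ≠ 2 * l + 1 := by omega
    have d3 : 2 * j + 1 ≠ 2 * l := by omega
    rcases hcase x hxj with rfl | rfl | h
    · simp [hi, d1, d2]
    · simp [hi, hdiv', d1, d3]
    · obtain ⟨b1, b2, b3, b4, b5⟩ := hx x h
      have c1 : x ≠ 2 * j := by omega
      have c2 : x ≠ 2 * j + 1 := by omega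
      simp [b1, b2, b3, b4, b5, c1, c2]

/-- Register 4 is increased before the bag is read, so it serves both as the index of the end of the
bag and as its group number, which is one more than its index. -/
theorem bagBody_runs {A : ℕ → ℕ → ℕ} {g : ℕ → ℕ} {p r i K : ℕ} {start : ℕ → ℕ}
    (hB : 2 * start (i + 1) ≤ B) (hr : r ≤ B) (hi : i < r) (hst : A 2 (i + 1) = start (i + 1))
    (hle : start i ≤ start (i + 1)) (hK : start (i + 1) ≤ start i + K)
    (hg : ∀ q, start i ≤ q → q < start (i + 1) → g q = i + 1)
    (h : s.reg 4 = i ∧ WordInv A g p r (start i) s) :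
    Runs B bagBody s (K * 25 + 4) fun s' =>
      s'.reg 4 = i + 1 ∧ WordInv A g p r (start (i + 1)) s' := by
  obtain ⟨h4, h⟩ := h
  have h' := h
  obtain ⟨h0, h2, h3, h5, h6, h11, a2, -⟩ := h'
  refine Runs.mono (T := 1 + (1 + (((start (i + 1) - start i) * (24 + 1) + 1) + 1)))
    (Q := fun s' => s'.reg 4 = i + 1 ∧ WordInv A g p r (start (i + 1)) s') ?_ (by omega)
    fun _ h => h
  refine Runs.seq (runs_of_wp (c := .arith .add 4 4 3) ⟨?_, ?_⟩)
  · simp [Op.eval, h4, h3]; omega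
  refine Runs.seq (runs_of_wp (c := .load 7 2 4) ?_)
  refine Runs.seq (Runs.loop (fun j s' => (s'.reg 4 = i + 1 ∧ s'.reg 7 = start (i + 1)) ∧
    WordInv A g p r (start i + j) s') ?_ ?_ ?_ ?_ ?_)
  · refine ⟨?_, ?_⟩
    · simp [Op.eval, h3, h4, a2, hst]
    · simpa [WordInv, Op.eval] using h
  · rintro j hj s ⟨⟨-, g7⟩, -, -, -, g5, -⟩
    omega
  · rintro s ⟨⟨-, g7⟩, -, -, -, g5, -⟩
    omega
  · rintro j hj s ⟨⟨g4, g7⟩, hs⟩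
    exact incidenceBody_runs (j := start i + j) (by omega) (hg _ (by omega) (by omega)) g4 g7 hs
  · rintro s ⟨⟨g4, g7⟩, hs⟩
    rw [Nat.add_sub_cancel' hle] at hs
    exact runs_of_wp (c := .skip) ⟨g4, hs⟩

theorem bagCode_runs {A : ℕ → ℕ → ℕ} {g : ℕ → ℕ} {p r K : ℕ} {start : ℕ → ℕ}
    (hB : 2 * start r ≤ B) (hr : r ≤ B) (hst : ∀ i < r, A 2 (i + 1) = start (i + 1))
    (h00 : start 0 = 0) (hmono : Monotone start) (hK : ∀ i < r, start (i + 1) ≤ start i + K)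
    (hg : ∀ i < r, ∀ q, start i ≤ q → q < start (i + 1) → g q = i + 1)
    (h0 : s.reg 0 = p) (h2 : s.reg 2 = r) (h3 : s.reg 3 = 1) (ha : s.arr = A) (h7 : A 7 = 0) :
    Runs B bagCode s (r * (K * 25 + 4 + 1) + 6) (WordInv A g p r (start r)) := by
  refine Runs.mono (T := 1 + (1 + (1 + (1 + ((r * (K * 25 + 4 + 1) + 1) + 1)))))
    (Q := WordInv A g p r (start r)) ?_ (by omega) fun _ h => h
  refine Runs.seq (runs_of_wp (c := .const 4 0) ⟨Nat.zero_le _, ?_⟩)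
  refine Runs.seq (runs_of_wp (c := .const 5 0) ⟨Nat.zero_le _, ?_⟩)
  refine Runs.seq (runs_of_wp (c := .const 6 0) ⟨Nat.zero_le _, ?_⟩)
  refine Runs.seq (runs_of_wp (c := .const 11 0) ⟨Nat.zero_le _, ?_⟩)
  refine Runs.seq (Runs.loop (fun i s' => s'.reg 4 = i ∧ WordInv A g p r (start i) s')
    ?_ ?_ ?_ ?_ ?_)
  · rw [h00]
    simp [WordInv, h0, h2, h3, ha, h7]
    rfl
  · rintro j hj s ⟨g4, -, g2, -⟩
    omega
  · rintro s ⟨g4, -, g2, -⟩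
    omega
  · intro i hi s hs
    have := hmono (Nat.succ_le_of_lt hi)
    exact bagBody_runs (by simp only [Nat.succ_eq_add_one] at this; omega) hr hi (hst i hi)
      (hmono (Nat.le_succ i)) (hK i hi) (hg i hi) hs
  · exact fun s hs => runs_of_wp (c := .skip) hs.2

end RAM

/-! ### Writing sorted lists -/

/-- The number of keys below `z`. -/
def rankBelow (n : ℕ) (key : ℕ → ℕ) (z : ℕ) : ℕ := ((Finset.range n).filter fun y => key y < z).card

theorem rankBelow_le (n : ℕ) (key : ℕ → ℕ) (z : ℕ) : rankBelow n key z ≤ n := by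
  conv_rhs => rw [← Finset.card_range n]
  exact Finset.card_filter_le _ _

theorem rankBelow_lt {n : ℕ} {key : ℕ → ℕ} {y z : ℕ} (hy : y < n) (h : key y < z) :
    rankBelow n key (key y) < rankBelow n key z := by
  refine Finset.card_lt_card ((Finset.ssubset_iff_of_subset fun w hw => ?_).2 ⟨y, ?_, ?_⟩)
  · simp only [Finset.mem_filter] at hw ⊢
    exact ⟨hw.1, hw.2.trans h⟩
  · simpa using ⟨hy, h⟩
  · simp

theorem rankBelow_zero (n : ℕ) (key : ℕ → ℕ) : rankBelow n key 0 = 0 := by simp [rankBelow]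

theorem rankBelow_succ_of_ne {n : ℕ} {key : ℕ → ℕ} {z : ℕ} (h : ∀ y < n, key y ≠ z) :
    rankBelow n key (z + 1) = rankBelow n key z := by
  refine congrArg Finset.card (Finset.filter_congr fun y hy => ?_)
  have := h y (Finset.mem_range.1 hy)
  omega

/-- With `rankBelow_succ_of_ne` this describes the write position as the threshold sweeps upwards:
it advances exactly when a key is met. -/
theorem rankBelow_succ {n : ℕ} {key : ℕ → ℕ} {x : ℕ} (hx : x < n)
    (h : ∀ y < n, key y = key x → y = x) :
    rankBelow n key (key x + 1) = rankBelow n key (key x) + 1 := by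
  have : ((Finset.range n).filter fun y => key y < key x + 1) =
      insert x ((Finset.range n).filter fun y => key y < key x) := by
    ext y
    simp only [Finset.mem_filter, Finset.mem_range, Finset.mem_insert]
    constructor
    · rintro ⟨h1, h2⟩
      rcases Nat.lt_succ_iff_lt_or_eq.1 h2 with h3 | h3
      · exact Or.inr ⟨h1, h3⟩
      · exact Or.inl (h y h1 h3)
    · rintro (rfl | ⟨h1, h2⟩)
      · exact ⟨hx, by omega⟩
      · exact ⟨h1, by omega⟩
  rw [rankBelow, this, Finset.card_insert_of_notMem (by simp), rankBelow]

theorem rankBelow_eq_of_forall_lt {n : ℕ} {key : ℕ → ℕ} {z : ℕ} (h : ∀ y < n, key y < z) :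
    rankBelow n key z = n := by
  rw [rankBelow, Finset.filter_true_of_mem fun y hy => h y (Finset.mem_range.1 hy),
    Finset.card_range]

theorem mul_add_injOn {n s s' x y : ℕ} (hx : x < n) (hy : y < n) (h : s * n + x = s' * n + y) :
    s = s' ∧ x = y := by
  have h1 : (n * s + x) / n = s := by
    rw [Nat.mul_add_div (by omega), Nat.div_eq_of_lt hx, add_zero]
  have h2 : (n * s' + y) / n = s' := by
    rw [Nat.mul_add_div (by omega), Nat.div_eq_of_lt hy, add_zero]
  have h3 : s = s' := by rw [← h1, ← h2, mul_comm n s, mul_comm n s', h]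
  subst h3
  exact ⟨rfl, by omega⟩

namespace RAM

variable {B : ℕ} {s : State} {Q : State → Prop}

/-- If the registers `x` and `y` are equal, run `c`, else run `d`. -/
def ifEq (x y : ℕ) (c d : Prog) : Prog := .ite x y d (.ite y x d c)

theorem wp_ifEq {x y : ℕ} {c d : Prog} (h1 : s.reg x = s.reg y → wp B c Q s)
    (h2 : s.reg x ≠ s.reg y → wp B d Q s) : wp B (ifEq x y c d) Q s :=
  ⟨fun h => h2 h.ne, fun h => ⟨fun h' => h2 h'.ne', fun h' => h1 (by omega)⟩⟩

/-- The last two sections. -/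
def sectionTail : Prog := ifEq 21 18 (.const 22 3) (.const 22 4)

/-- The section of a member of the same group. -/
def sectionAdj (adj : ℕ) : Prog := .seq (.load 24 12 21) (.seq (.arith .mul 24 24 0)
  (.seq (.arith .add 24 24 19) (.seq (.load 24 adj 24) (.ite 11 24 (.const 22 2) sectionTail))))

/-- Compute the section of the item in register 21 in the list of the agent in register 15. -/
def sectionCode (adj : ℕ) : Prog := .seq (.load 23 6 21) (.seq (.arith .add 24 23 3)
  (.ite 24 16 (.const 22 0)
    (ifEq 21 17 (.const 22 1) (ifEq 23 16 (sectionAdj adj) sectionTail))))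

/-- Append the item in register 21 if it belongs to the section in register 20. -/
def itemBody (out adj : ℕ) : Prog := .seq (sectionCode adj)
  (.seq (ifEq 22 20 (.seq (.store out 14 21) (.arith .add 14 14 3)) .skip) (.arith .add 21 21 3))

/-- Append a section. -/
def rowBody (out adj : ℕ) : Prog :=
  seqs [.const 21 0, .loop 21 6 (itemBody out adj), .arith .add 20 20 3]

/-- Append the list of an agent. -/
def agentBody (out F S adj : ℕ) : Prog := seqs [.load 16 6 15, .load 17 F 15, .load 18 S 15,
  .load 19 12 15, .const 20 0, .loop 20 13 (rowBody out adj), .arith .add 15 15 3]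

/-- Write all lists of one sex. -/
def listsCode (out F S adj : ℕ) : Prog := seqs [.const 13 5, .const 14 0, .const 15 0,
  .loop 15 6 (agentBody out F S adj)]

/-- The sections of the list of `a`, read off from the arrays. -/
noncomputable def arraySection (A : ℕ → ℕ → ℕ) (p F S adj a : ℕ) : ℕ → ℕ :=
  listSection (A 6) (fun y => 0 < A adj (A 12 y * p + A 12 a)) a (A F a) (A S a)

/-- The sorting key of the list of `a`. -/
noncomputable def arrayKey (A : ℕ → ℕ → ℕ) (p n F S adj a x : ℕ) : ℕ :=
  arraySection A p F S adj a x * n + x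

/-- The lists are written up to key `z` of agent `a`. -/
def Written (A : ℕ → ℕ → ℕ) (p n out F S adj a z : ℕ) (s : State) : Prop :=
  ∀ a' < n, ∀ y < n, a' < a ∨ a' = a ∧ arrayKey A p n F S adj a' y < z →
    s.arr out (a' * n + rankBelow n (arrayKey A p n F S adj a') (arrayKey A p n F S adj a' y)) = y

/-- What the list writer does not change. -/
def ListEnv (A : ℕ → ℕ → ℕ) (p n out : ℕ) (s : State) : Prop :=
  s.reg 0 = p ∧ s.reg 3 = 1 ∧ s.reg 6 = n ∧ s.reg 11 = 0 ∧ s.reg 13 = 5 ∧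
    ∀ b ≠ out, s.arr b = A b

/-- The registers that belong to the agent `a`. -/
def AgentRegs (A : ℕ → ℕ → ℕ) (F S a : ℕ) (s : State) : Prop :=
  s.reg 15 = a ∧ s.reg 16 = A 6 a ∧ s.reg 17 = A F a ∧ s.reg 18 = A S a ∧ s.reg 19 = A 12 a

theorem sectionCode_runs {A : ℕ → ℕ → ℕ} {p n out F S adj a x : ℕ} (h6 : out ≠ 6)
    (h12 : out ≠ 12) (hadj : out ≠ adj) (hB : 5 ≤ B) (hbg : A 6 x + 1 ≤ B)
    (hown : A 12 x * p + A 12 a ≤ B) (he : ListEnv A p n out s) (ha : AgentRegs A F S a s)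
    (hx : s.reg 21 = x)
    (hQ : ∀ s', s'.reg 22 = arraySection A p F S adj a x → s'.arr = s.arr →
      (∀ z < 22, s'.reg z = s.reg z) → Q s') :
    wp B (sectionCode adj) Q s := by
  obtain ⟨r0, r3, -, r11, -, harr⟩ := he
  obtain ⟨r15, r16, r17, r18, r19⟩ := ha
  have hA6 := harr 6 h6.symm
  have hA12 := harr 12 h12.symm
  have hAadj := harr adj hadj.symm
  have hne : ∀ z < 22, z ≠ 22 ∧ z ≠ 23 ∧ z ≠ 24 := fun z hz => by omega
  -- The last two sections are reached both from another group and from a non-adjacent member of the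
  -- same group; one statement serves both exits.
  have tail : ∀ s', s'.arr = s.arr → (∀ z < 22, s'.reg z = s.reg z) →
      ¬ A 6 x + 1 < A 6 a → x ≠ A F a →
      ¬ (A 6 x = A 6 a ∧ 0 < A adj (A 12 x * p + A 12 a)) → wp B sectionTail Q s' := by
    intro s' h1 h2 c1 c2 c3
    refine wp_ifEq (fun c4 => ⟨by omega, hQ _ ?_ h1 fun z hz => ?_⟩)
      (fun c4 => ⟨by omega, hQ _ ?_ h1 fun z hz => ?_⟩)
    · rw [h2 21 (by omega), h2 18 (by omega), hx, r18] at c4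
      change 3 = _
      rw [arraySection, listSection, if_neg c1, if_neg c2, if_neg c3, if_pos c4]
    · simp [hne z hz, h2 z hz]
    · rw [h2 21 (by omega), h2 18 (by omega), hx, r18] at c4
      change 4 = _
      rw [arraySection, listSection, if_neg c1, if_neg c2, if_neg c3, if_neg c4]
    · simp [hne z hz, h2 z hz]
  refine ⟨by simp [Op.eval, hA6, hx, r3]; omega, fun c1 => ⟨by omega, hQ _ ?_ rfl fun z hz => ?_⟩,
    fun c1 => wp_ifEq (fun c2 => ⟨by omega, hQ _ ?_ rfl fun z hz => ?_⟩) fun c2 =>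
      wp_ifEq (fun c3 => ?_) fun c3 => tail _ rfl (fun z hz => ?_) ?_ ?_ ?_⟩
  all_goals simp [Op.eval, hA6, hx, r3, r16] at c1
  · simp [arraySection, listSection, c1]
  · simp [hne z hz]
  · simp [hx, r17] at c2
    change 1 = _
    rw [arraySection, listSection, if_neg (by omega), if_pos c2]
  · simp [hne z hz]
  · simp [hx, r17] at c2
    simp [hx, r16, hA6] at c3
    refine ⟨?_, ?_, fun c4 => ⟨by omega, hQ _ ?_ rfl fun z hz => ?_⟩,
      fun c4 => tail _ rfl (fun z hz => ?_) ?_ ?_ ?_⟩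
    all_goals simp [Op.eval, hA12, hx, r0, r19, hAadj, r11] at *
    · omega
    · omega
    · rw [arraySection, listSection, if_neg (by omega), if_neg c2, if_pos ⟨c3, c4⟩]
    · simp [hne z hz]
    · simp [hne z hz]
    · omega
    · exact c2
    · exact fun _ => c4
  · simp [hne z hz]
  · omega
  · simpa [hx, r17] using c2
  · simp [hx, r16, hA6] at c3
    exact fun h => c3 h.1

/-- The nested loops over sections `t` and items `x` form one sweep of the threshold `t * n + x`.
The item scanned has this key exactly when it lies in section `t`, so the write pointer is always
the number of keys below the threshold. -/
theorem itemBody_runs {A : ℕ → ℕ → ℕ} {p n out F S adj a t x : ℕ} (h6 : out ≠ 6)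
    (h12 : out ≠ 12) (hadj : out ≠ adj) (hB : 5 ≤ B) (hbg : A 6 x + 1 ≤ B) (hnB : n * n ≤ B)
    (hown : A 12 x * p + A 12 a ≤ B) (han : a < n) (hxn : x < n)
    (he : ListEnv A p n out s) (ha : AgentRegs A F S a s) (ht : s.reg 20 = t) (hx : s.reg 21 = x)
    (hptr : s.reg 14 = a * n + rankBelow n (arrayKey A p n F S adj a) (t * n + x))
    (hw : Written A p n out F S adj a (t * n + x) s) :
    Runs B (itemBody out adj) s 20 fun s' =>
      ListEnv A p n out s' ∧ AgentRegs A F S a s' ∧ s'.reg 20 = t ∧ s'.reg 21 = x + 1 ∧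
        s'.reg 14 = a * n + rankBelow n (arrayKey A p n F S adj a) (t * n + x + 1) ∧
        Written A p n out F S adj a (t * n + x + 1) s' := by
  refine (runs_of_wp (c := itemBody out adj) ?_).mono ?_ fun _ h => h
  · refine sectionCode_runs h6 h12 hadj hB hbg hown he ha hx fun s' e22 earr ereg => ?_
    obtain ⟨r0, r3, r6, r11, r13, harr⟩ := he
    obtain ⟨r15, r16, r17, r18, r19⟩ := ha
    have hnn : n ≤ n * n := Nat.le_mul_self n
    have hinj : ∀ a y, y < n → ∀ t', arrayKey A p n F S adj a y = t' * n + x →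
        arraySection A p F S adj a y = t' ∧ y = x := fun a y hy t' h =>
      mul_add_injOn hy hxn h
    refine wp_ifEq (fun c => ?_) fun c => ?_
    · rw [e22, ereg 20 (by omega), ht] at c
      have hkey : t * n + x = arrayKey A p n F S adj a x := by rw [arrayKey, c]
      have hsucc := rankBelow_succ (key := arrayKey A p n F S adj a) hxn
        (fun y hy h => (hinj a y hy t (h.trans hkey.symm)).2)
      have hle := rankBelow_le n (arrayKey A p n F S adj a) (arrayKey A p n F S adj a x + 1)
      have hmul : (a + 1) * n ≤ n * n := Nat.mul_le_mul_right n han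
      rw [Nat.succ_mul] at hmul
      rw [hkey] at hptr hw ⊢
      simp [wp, Op.eval, ereg, earr, ListEnv, AgentRegs, r0, r3, r6, r11, r13, r15, r16, r17, r18,
        r19, hptr, hx, ht]
      refine ⟨by omega, by omega, fun b hb => ?_, by omega, ?_⟩
      · rw [Function.update_of_ne hb, harr b hb]
      · intro a' ha' y hy h
        simp only [State.setReg_arr, State.setArr_arr, Function.update_self, earr]
        rcases h with h | ⟨rfl, h⟩
        · have h1 := rankBelow_lt (key := arrayKey A p n F S adj a') hy (Nat.lt_succ_self _)
          have h2 := rankBelow_le n (arrayKey A p n F S adj a') (arrayKey A p n F S adj a' y).succ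
          have h3 : (a' + 1) * n ≤ a * n := Nat.mul_le_mul_right n h
          rw [Nat.succ_mul] at h3
          rw [Function.update_of_ne (by omega)]
          exact hw a' ha' y hy (Or.inl h)
        · by_cases hyx : y = x
          · rw [hyx, Function.update_self]
          · have h1 : arrayKey A p n F S adj a' y ≠ arrayKey A p n F S adj a' x := fun h1 =>
              hyx (hinj a' y hy t (h1.trans hkey.symm)).2
            have h2 : arrayKey A p n F S adj a' y < arrayKey A p n F S adj a' x := by omega
            have h3 := rankBelow_lt hy h2
            rw [Function.update_of_ne (by omega)]
            exact hw a' ha' y hy (Or.inr ⟨rfl, h2⟩)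
    · rw [e22, ereg 20 (by omega), ht] at c
      have hne : ∀ y < n, arrayKey A p n F S adj a y ≠ t * n + x := fun y hy h => by
        obtain ⟨h1, rfl⟩ := hinj a y hy t h
        exact c h1
      rw [rankBelow_succ_of_ne hne]
      simp [wp, Op.eval, ereg, earr, ListEnv, AgentRegs, r0, r3, r6, r11, r13, r15, r16, r17, r18,
        r19, hptr, hx, ht]
      refine ⟨by omega, harr, ?_⟩
      intro a' ha' y hy h
      simp only [State.setReg_arr, earr]
      refine hw a' ha' y hy (h.imp_right ?_)
      rintro ⟨rfl, h⟩
      have := hne y hy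
      exact ⟨rfl, by omega⟩
  · simp only [itemBody, sectionCode, sectionAdj, sectionTail, ifEq, cost]
    decide

theorem rowBody_runs {A : ℕ → ℕ → ℕ} {p n out F S adj a t : ℕ} (h6 : out ≠ 6)
    (h12 : out ≠ 12) (hadj : out ≠ adj) (hB : 5 ≤ B) (hbg : ∀ x < n, A 6 x + 1 ≤ B)
    (hnB : n * n ≤ B) (hown : ∀ x < n, A 12 x * p + A 12 a ≤ B) (han : a < n) (ht5 : t < 5)
    (he : ListEnv A p n out s) (ha : AgentRegs A F S a s) (ht : s.reg 20 = t)
    (hptr : s.reg 14 = a * n + rankBelow n (arrayKey A p n F S adj a) (t * n))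
    (hw : Written A p n out F S adj a (t * n) s) :
    Runs B (rowBody out adj) s (n * 21 + 4) fun s' =>
      ListEnv A p n out s' ∧ AgentRegs A F S a s' ∧ s'.reg 20 = t + 1 ∧
        s'.reg 14 = a * n + rankBelow n (arrayKey A p n F S adj a) ((t + 1) * n) ∧
        Written A p n out F S adj a ((t + 1) * n) s' := by
  refine Runs.mono (T := 1 + ((n * (20 + 1) + 1) + (1 + 1))) (Q := fun s' =>
    ListEnv A p n out s' ∧ AgentRegs A F S a s' ∧ s'.reg 20 = t + 1 ∧
        s'.reg 14 = a * n + rankBelow n (arrayKey A p n F S adj a) ((t + 1) * n) ∧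
        Written A p n out F S adj a ((t + 1) * n) s') ?_ (by omega) fun _ h => h
  refine Runs.seq (runs_of_wp (c := .const 21 0) ⟨Nat.zero_le _, ?_⟩)
  refine Runs.seq (Runs.loop (fun x s' => ListEnv A p n out s' ∧ AgentRegs A F S a s' ∧
    s'.reg 20 = t ∧ s'.reg 21 = x ∧
    s'.reg 14 = a * n + rankBelow n (arrayKey A p n F S adj a) (t * n + x) ∧
    Written A p n out F S adj a (t * n + x) s') ?_ ?_ ?_ ?_ ?_)
  · simpa [ListEnv, AgentRegs, Written] using ⟨he, ha, ht, hptr, hw⟩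
  · rintro x hx s ⟨⟨-, -, e6, -⟩, -, -, e21, -⟩
    omega
  · rintro s ⟨⟨-, -, e6, -⟩, -, -, e21, -⟩
    omega
  · rintro x hx s ⟨e1, e2, e3, e4, e5, e6⟩
    exact itemBody_runs h6 h12 hadj hB (hbg x hx) hnB (hown x hx) han hx e1 e2 e3 e4 e5 e6
  · rintro s ⟨e1, e2, e3, e4, e5, e6⟩
    have e3' := e1.2.1
    refine Runs.seq (runs_of_wp (c := .arith .add 20 20 3)
      ⟨?_, runs_of_wp (c := .skip) (?_ : _ ∧ _)⟩)
    · simp only [Op.eval]; omega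
    · rw [Nat.succ_mul]
      simpa [Op.eval, e3, e3', ListEnv, AgentRegs, Written] using And.intro e1 ⟨e2, e5, e6⟩

theorem agentBody_runs {A : ℕ → ℕ → ℕ} {p n out F S adj a : ℕ} (h6 : out ≠ 6)
    (h12 : out ≠ 12) (hadj : out ≠ adj) (hF : out ≠ F) (hS : out ≠ S) (hB : 5 ≤ B)
    (hbg : ∀ x < n, A 6 x + 1 ≤ B) (hnB : n * n ≤ B)
    (hown : ∀ x < n, A 12 x * p + A 12 a ≤ B) (han : a < n)
    (he : ListEnv A p n out s) (ha : s.reg 15 = a) (hptr : s.reg 14 = a * n)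
    (hw : Written A p n out F S adj a 0 s) :
    Runs B (agentBody out F S adj) s (n * 105 + 33) fun s' =>
      ListEnv A p n out s' ∧ s'.reg 15 = a + 1 ∧ s'.reg 14 = (a + 1) * n ∧
        Written A p n out F S adj (a + 1) 0 s' := by
  refine Runs.mono (T := 1 + (1 + (1 + (1 + (1 + ((5 * ((n * 21 + 4) + 1) + 1) + (1 + 1)))))))
    (Q := fun s' => ListEnv A p n out s' ∧ s'.reg 15 = a + 1 ∧ s'.reg 14 = (a + 1) * n ∧
        Written A p n out F S adj (a + 1) 0 s') ?_ (by omega) fun _ h => h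
  obtain ⟨r0, r3, r6, r11, r13, harr⟩ := he
  refine Runs.seq (runs_of_wp (c := .load 16 6 15) ?_)
  refine Runs.seq (runs_of_wp (c := .load 17 F 15) ?_)
  refine Runs.seq (runs_of_wp (c := .load 18 S 15) ?_)
  refine Runs.seq (runs_of_wp (c := .load 19 12 15) ?_)
  refine Runs.seq (runs_of_wp (c := .const 20 0) ⟨Nat.zero_le _, ?_⟩)
  refine Runs.seq (Runs.loop (fun t s' => ListEnv A p n out s' ∧ AgentRegs A F S a s' ∧
    s'.reg 20 = t ∧ s'.reg 14 = a * n + rankBelow n (arrayKey A p n F S adj a) (t * n) ∧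
    Written A p n out F S adj a (t * n) s') ?_ ?_ ?_ ?_ ?_)
  · simp [ListEnv, AgentRegs, r0, r3, r6, r11, r13, ha, hptr, rankBelow_zero, harr 6 h6.symm,
      harr F hF.symm, harr S hS.symm, harr 12 h12.symm]
    exact ⟨harr, by simpa [Written] using hw⟩
  · rintro t ht s ⟨⟨-, -, -, -, e13, -⟩, -, e20, -⟩
    omega
  · rintro s ⟨⟨-, -, -, -, e13, -⟩, -, e20, -⟩
    omega
  · rintro t ht s ⟨e1, e2, e3, e4, e5⟩
    exact rowBody_runs h6 h12 hadj hB hbg hnB hown han ht e1 e2 e3 e4 e5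
  · rintro s ⟨e1, e2, e3, e4, e5⟩
    -- There are five sections, so the sweep up to `5 * n` has passed every key and the pointer
    -- stands at the start of the next agent's list.
    have hkey : ∀ a, ∀ y < n, arrayKey A p n F S adj a y < 5 * n := fun a y hy => by
      have h1 : arraySection A p F S adj a y ≤ 4 := listSection_le _ _ _ _ _ _
      have h2 := Nat.mul_le_mul_right n h1
      rw [arrayKey]
      omega
    rw [rankBelow_eq_of_forall_lt (hkey a), ← Nat.succ_mul] at e4
    have r3 := e1.2.1
    have r15 := e2.1
    have hnn : n ≤ n * n := Nat.le_mul_self n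
    refine Runs.seq (runs_of_wp (c := .arith .add 15 15 3)
      ⟨?_, runs_of_wp (c := .skip) (?_ : _ ∧ _)⟩)
    · simp only [Op.eval]; omega
    · simp [Op.eval, r3, r15, e4]
      refine ⟨by simpa [ListEnv] using e1, fun a' ha' y hy h => e5 a' ha' y hy ?_⟩
      rcases h with h | ⟨-, h⟩
      · rcases Nat.lt_succ_iff_lt_or_eq.1 h with h | h
        · exact Or.inl h
        · exact Or.inr ⟨h, hkey a' y hy⟩
      · omega

theorem listsCode_runs {A : ℕ → ℕ → ℕ} {p n out F S adj : ℕ} (h6 : out ≠ 6)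
    (h12 : out ≠ 12) (hadj : out ≠ adj) (hF : out ≠ F) (hS : out ≠ S) (hB : 5 ≤ B)
    (hbg : ∀ x < n, A 6 x + 1 ≤ B) (hnB : n * n ≤ B)
    (hown : ∀ a < n, ∀ x < n, A 12 x * p + A 12 a ≤ B) (ha : s.arr = A) (r0 : s.reg 0 = p)
    (r3 : s.reg 3 = 1) (r6 : s.reg 6 = n) (r11 : s.reg 11 = 0) :
    Runs B (listsCode out F S adj) s (n * (n * 105 + 34) + 5) fun s' =>
      ListEnv A p n out s' ∧ ∀ a < n, ∀ y < n, s'.arr out (a * n +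
        rankBelow n (arrayKey A p n F S adj a) (arrayKey A p n F S adj a y)) = y := by
  refine Runs.mono (T := 1 + (1 + (1 + ((n * (n * 105 + 33 + 1) + 1) + 1))))
    (Q := fun s' => ListEnv A p n out s' ∧ ∀ a < n, ∀ y < n, s'.arr out (a * n +
        rankBelow n (arrayKey A p n F S adj a) (arrayKey A p n F S adj a y)) = y) ?_ (le_of_eq (by ring))
    fun _ h => h
  refine Runs.seq (runs_of_wp (c := .const 13 5) ⟨hB, ?_⟩)
  refine Runs.seq (runs_of_wp (c := .const 14 0) ⟨Nat.zero_le _, ?_⟩)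
  refine Runs.seq (runs_of_wp (c := .const 15 0) ⟨Nat.zero_le _, ?_⟩)
  refine Runs.seq (Runs.loop (fun a s' => ListEnv A p n out s' ∧ s'.reg 15 = a ∧
    s'.reg 14 = a * n ∧ Written A p n out F S adj a 0 s') ?_ ?_ ?_ ?_ ?_)
  · simp [ListEnv, r0, r3, r6, r11, ha, Written]
  · rintro t ht s ⟨⟨-, -, e6, -⟩, e15, -⟩
    omega
  · rintro s ⟨⟨-, -, e6, -⟩, e15, -⟩
    omega
  · rintro a han s ⟨e1, e2, e3, e4⟩
    exact agentBody_runs h6 h12 hadj hF hS hB hbg hnB (hown a han) han e1 e2 e3 e4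
  · rintro s ⟨e1, e2, e3, e4⟩
    exact runs_of_wp (c := .skip) ⟨e1, fun a ha y hy => e4 a ha y hy (Or.inl ha)⟩

end RAM

/-! ### The complete program -/

namespace RAM

/-- The whole construction. -/
def mainCode : Prog :=
  seqs [edgeCode, bagCode, listsCode 4 13 8 10, listsCode 5 9 13 11, .copy 0 6]

/-- What the list writer needs to know about its input arrays. -/
structure Prepared (A : ℕ → ℕ → ℕ) (p n : ℕ) (E : List (ℕ × ℕ)) (L : List (List ℕ)) : Prop where
  bg : ∀ x < n, A 6 x = bagNumber L (x / 2)
  own : ∀ x < n, A 12 x = L.flatten.getD (x / 2) 0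
  self : ∀ x < n, A 13 x = x
  perm : ∀ x < n, A 8 x = foldPerm (fun q => L.flatten.getD q 0) L.flatten.length x
  symm : ∀ x < n, A 9 x = (foldPerm (fun q => L.flatten.getD q 0) L.flatten.length).symm x
  adj : ∀ z, 0 < A 10 z ↔ ∃ e ∈ E, e.1 * p + e.2 = z
  adj' : ∀ z, 0 < A 11 z ↔ ∃ e ∈ E, e.2 * p + e.1 = z

theorem exists_lt_getD_iff (E : List (ℕ × ℕ)) (P : ℕ → ℕ → Prop) :
    (∃ t < E.length, P ((E.map Prod.fst).getD t 0) ((E.map Prod.snd).getD t 0)) ↔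
      ∃ e ∈ E, P e.1 e.2 := by
  constructor
  · rintro ⟨t, ht, h⟩
    rw [List.getD_eq_getElem _ _ (by simpa using ht), List.getD_eq_getElem _ _ (by simpa using ht),
      List.getElem_map, List.getElem_map] at h
    exact ⟨_, List.getElem_mem ht, h⟩
  · rintro ⟨e, he, h⟩
    obtain ⟨t, ht, rfl⟩ := List.getElem_of_mem he
    refine ⟨t, ht, ?_⟩
    rwa [List.getD_eq_getElem _ _ (by simpa using ht), List.getD_eq_getElem _ _ (by simpa using ht),
      List.getElem_map, List.getElem_map]

/-- Both sexes use the same list writer: men take the identity array and the array of `σ` as first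
and second partners, women the array of `σ⁻¹` and the identity. The transposed matrix keeps the
woman's vertex below the man's when she owns the list. -/
theorem mainCode_runs {B p K : ℕ} {E : List (ℕ × ℕ)} {L : List (List ℕ)}
    (hE : ∀ e ∈ E, e.1 < p ∧ e.2 < p) (hL : ∀ q < L.flatten.length, L.flatten.getD q 0 < p)
    (hK : ∀ l ∈ L, l.length ≤ K) (hB : 5 ≤ B) (hBE : E.length ≤ B) (hBp : p * p ≤ B)
    (hBr : L.length + 1 ≤ B) (hBn : 2 * L.flatten.length * (2 * L.flatten.length) ≤ B) :
    Runs B mainCode (inputState p E L)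
      (E.length * 11 + 3 + (L.length * (K * 25 + 5) + 6) +
        2 * (2 * L.flatten.length * (2 * L.flatten.length * 105 + 34) + 5) + 2)
      fun s => s.reg 0 = 2 * L.flatten.length ∧
        ∃ A, Prepared A p (2 * L.flatten.length) E L ∧
          (∀ a < 2 * L.flatten.length, ∀ y < 2 * L.flatten.length,
            s.arr 4 (a * (2 * L.flatten.length) + rankBelow (2 * L.flatten.length)
              (arrayKey A p (2 * L.flatten.length) 13 8 10 a)
              (arrayKey A p (2 * L.flatten.length) 13 8 10 a y)) = y) ∧
          ∀ a < 2 * L.flatten.length, ∀ y < 2 * L.flatten.length,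
            s.arr 5 (a * (2 * L.flatten.length) + rankBelow (2 * L.flatten.length)
              (arrayKey A p (2 * L.flatten.length) 9 13 11 a)
              (arrayKey A p (2 * L.flatten.length) 9 13 11 a y)) = y := by
  set n := 2 * L.flatten.length with hn
  have hidx : ∀ u v, u < p → v < p → u * p + v ≤ B := fun u v hu hv => by
    have h1 : (u + 1) * p ≤ p * p := Nat.mul_le_mul_right p hu
    rw [Nat.succ_mul] at h1
    omega
  have hnn : n ≤ n * n := Nat.le_mul_self n
  refine Runs.mono (T := 1 + (E.length * 11 + 1 + 1) + ((L.length * (K * 25 + 4 + 1) + 6) +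
    ((n * (n * 105 + 34) + 5) + ((n * (n * 105 + 34) + 5) + (1 + 1))))) ?_
    (le_of_eq (by ring)) fun _ h => h
  refine Runs.seq ((edgeCode_runs (A := (inputState p E L).arr) (m := E.length) (p := p)
    (r := L.length) hBE (by omega) ?_ rfl rfl rfl rfl rfl rfl rfl).mono le_rfl fun s1 h1 => ?_)
  · intro j hj
    change (E.map Prod.fst).getD j 0 * p + (E.map Prod.snd).getD j 0 ≤ B ∧
      (E.map Prod.snd).getD j 0 * p + (E.map Prod.fst).getD j 0 ≤ B
    rw [List.getD_eq_getElem _ _ (by simpa using hj), List.getD_eq_getElem _ _ (by simpa using hj),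
      List.getElem_map, List.getElem_map]
    have := hE _ (List.getElem_mem hj)
    exact ⟨hidx _ _ this.1 this.2, hidx _ _ this.2 this.1⟩
  obtain ⟨r0, r1, r2, r3, r4, ha, hadj, hadj'⟩ := h1
  have hstart : ∀ i ≤ L.length, s1.arr 2 i = bagStart L i := fun i hi => by
    rw [ha 2 (by decide) (by decide)]
    exact if_pos hi
  have hword : s1.arr 3 = fun q => L.flatten.getD q 0 := by
    rw [ha 3 (by decide) (by decide)]
    rfl
  refine Runs.seq ((bagCode_runs (A := s1.arr) (g := bagNumber L) (p := p) (r := L.length) (K := K)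
    (start := bagStart L) ?_ (by omega) (fun i hi => hstart _ hi) rfl (bagStart_mono L)
    (fun i hi => ?_) (fun i hi q => bagNumber_eq L hi) r0 r2 r3 rfl ?_).mono le_rfl fun s2 h2 => ?_)
  · rw [bagStart_length]; omega
  · have := hK _ (List.getElem_mem hi)
    rw [bagStart_succ L hi]
    omega
  · rw [ha 7 (by decide) (by decide)]
    rfl
  obtain ⟨r0, r2, r3, r5, r6, r11, -, a3, a10, a11, -, hx⟩ := h2
  rw [bagStart_length] at r6 hx
  have hP : Prepared s2.arr p n E L := by
    constructor
    · exact fun x hxn => (hx x hxn).1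
    · exact fun x hxn => by rw [(hx x hxn).2.1, hword]
    · exact fun x hxn => (hx x hxn).2.2.1
    · exact fun x hxn => by rw [(hx x hxn).2.2.2.1, hword]
    · exact fun x hxn => by rw [(hx x hxn).2.2.2.2, hword]
    · intro z
      rw [a10, hadj z]
      exact exists_lt_getD_iff E fun u v => u * p + v = z
    · intro z
      rw [a11, hadj' z]
      exact exists_lt_getD_iff E fun u v => v * p + u = z
  have hbg : ∀ x < n, s2.arr 6 x + 1 ≤ B := fun x hxn => by
    rw [hP.bg x hxn]
    obtain ⟨i, hi, h1, -⟩ := bagNumber_spec L (q := x / 2) (by omega)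
    omega
  have hown : ∀ a < n, ∀ x < n, s2.arr 12 x * p + s2.arr 12 a ≤ B := fun a han x hxn => by
    rw [hP.own x hxn, hP.own a han]
    exact hidx _ _ (hL _ (by omega)) (hL _ (by omega))
  refine Runs.seq ((listsCode_runs (A := s2.arr) (p := p) (n := n) (out := 4) (F := 13) (S := 8)
    (adj := 10) (by decide) (by decide) (by decide) (by decide) (by decide) hB hbg hBn hown rfl r0
    r3 r6 r11).mono le_rfl fun s3 h3 => ?_)
  obtain ⟨⟨r0, r3, r6, r11, r13, harr⟩, hout⟩ := h3
  have e6 := harr 6 (by decide)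
  have e12 := harr 12 (by decide)
  have e13 := harr 13 (by decide)
  have e9 := harr 9 (by decide)
  have e11 := harr 11 (by decide)
  refine Runs.seq ((listsCode_runs (A := s3.arr) (p := p) (n := n) (out := 5) (F := 9) (S := 13)
    (adj := 11) (by decide) (by decide) (by decide) (by decide) (by decide) hB (by rwa [e6]) hBn
    (by rwa [e12]) rfl r0 r3 r6 r11).mono le_rfl fun s4 h4 => ?_)
  obtain ⟨⟨r0, r3, r6, r11, r13, harr'⟩, hout'⟩ := h4
  refine Runs.seq (runs_of_wp (c := .copy 0 6) (runs_of_wp (c := .skip) (?_ : _ ∧ _)))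
  refine ⟨by simpa using r6, s2.arr, hP, ?_, ?_⟩
  · rw [State.setReg_arr, harr' 4 (by decide)]
    exact hout
  -- Writing the men's lists changes only array 4, which the women's sorting keys do not read.
  · have hkey : ∀ a, arrayKey s3.arr p n 9 13 11 a = arrayKey s2.arr p n 9 13 11 a := fun a => by
      funext y
      simp only [arrayKey, arraySection, e6, e12, e13, e9, e11]
    intro a han y hy
    rw [← hkey]
    exact hout' a han y hy

end RAM

/-! ### Agreement of the written lists with the instance of the frame -/

/-- This identifies the position computed by the machine with the rank in the abstract instance once
the two sorting keys agree. -/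
theorem rankBelow_eq_rankEquiv {n : ℕ} {key : ℕ → ℕ} {sec : Fin n → ℕ}
    (h : ∀ y : Fin n, key y = listKey sec y) (w : Fin n) :
    rankBelow n key (key w) = rankEquiv _ (listKey_injective sec) w := by
  rw [rankEquiv_val, rankBelow, ← Finset.card_map Fin.valEmbedding]
  congr 1
  ext y
  simp only [Finset.mem_filter, Finset.mem_range, Finset.mem_map, Finset.mem_univ, true_and,
    Fin.valEmbedding_apply]
  constructor
  · rintro ⟨h1, h2⟩
    exact ⟨⟨y, h1⟩, by rwa [← h, ← h], rfl⟩
  · rintro ⟨y, h1, rfl⟩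
    exact ⟨y.2, by rwa [h, h]⟩

section Correctness

variable {V : Type*} [PartialOrder V] {p r : ℕ} {e : V ≃ Fin p} {edges : List (V × V)}

/-- Vertex numbers are below `p`, so a matrix cell determines both of its endpoints. -/
theorem exists_edge_iff {u v : V} (hedge : ∀ u v : V, (u, v) ∈ edges ↔ u ⋖ v)
    {a b : ℕ} (ha : a = e u) (hb : b = e v) :
    (∃ x ∈ edges.map fun x => ((e x.1 : ℕ), (e x.2 : ℕ)), x.1 * p + x.2 = a * p + b) ↔ u ⋖ v := by
  subst ha hb
  simp only [List.mem_map]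
  constructor
  · rintro ⟨-, ⟨⟨u', v'⟩, hx, rfl⟩, h⟩
    obtain ⟨h1, h2⟩ := mul_add_injOn (e v').2 (e v).2 h
    rw [← e.injective (Fin.ext h1), ← e.injective (Fin.ext h2)]
    exact (hedge _ _).1 hx
  · intro h
    exact ⟨_, ⟨(u, v), (hedge u v).2 h, rfl⟩, rfl⟩

theorem exists_edge_iff' {u v : V} (hedge : ∀ u v : V, (u, v) ∈ edges ↔ u ⋖ v)
    {a b : ℕ} (ha : a = e u) (hb : b = e v) :
    (∃ x ∈ edges.map fun x => ((e x.1 : ℕ), (e x.2 : ℕ)), x.2 * p + x.1 = b * p + a) ↔ u ⋖ v := by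
  subst ha hb
  simp only [List.mem_map]
  constructor
  · rintro ⟨-, ⟨⟨u', v'⟩, hx, rfl⟩, h⟩
    obtain ⟨h1, h2⟩ := mul_add_injOn (e u').2 (e u).2 h
    rw [← e.injective (Fin.ext h1), ← e.injective (Fin.ext h2)]
    exact (hedge _ _).1 hx
  · intro h
    exact ⟨_, ⟨(u, v), (hedge u v).2 h, rfl⟩, rfl⟩

variable [DecidableEq V] {X : Fin r → Finset V} {bag : Fin r → List V} {A : ℕ → ℕ → ℕ}
  (hbag : ∀ i, (bag i).Nodup ∧ (bag i).toFinset = X i)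
  (hX : IsPathDecomposition (SimpleGraph.hasse V) X)

theorem own_eq (hA : RAM.Prepared A p (2 * (numberedBags e bag).flatten.length)
    (edges.map fun x => ((e x.1 : ℕ), (e x.2 : ℕ))) (numberedBags e bag))
    (x : Fin (2 * (numberedBags e bag).flatten.length)) :
    A 12 x = e ((decompositionFrame e hbag hX).own x) := by
  rw [hA.own x x.2]
  simp [decompositionFrame, bagWord]

theorem arrayKey_man
    (hedge : ∀ u v : V, (u, v) ∈ edges ↔ u ⋖ v)
    (hA : RAM.Prepared A p (2 * (numberedBags e bag).flatten.length)
      (edges.map fun x => ((e x.1 : ℕ), (e x.2 : ℕ))) (numberedBags e bag))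
    (m y : Fin (2 * (numberedBags e bag).flatten.length)) :
    RAM.arrayKey A p (2 * (numberedBags e bag).flatten.length) 13 8 10 m y =
      listKey ((decompositionFrame e hbag hX).manSection m) y := by
  have h1 : A 13 m = m := hA.self m m.2
  have h2 : A 8 m = ((decompositionFrame e hbag hX).σ m : ℕ) := hA.perm m m.2
  rw [RAM.arrayKey, listKey, RAM.arraySection, h1, h2, listSection_comp Fin.val_injective,
    RotationFrame.manSection]
  congr 3
  · funext x
    exact hA.bg x x.2
  · funext x
    rw [hA.adj]
    exact propext (exists_edge_iff hedge (own_eq hbag hX hA x) (own_eq hbag hX hA m))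

theorem arrayKey_woman
    (hedge : ∀ u v : V, (u, v) ∈ edges ↔ u ⋖ v)
    (hA : RAM.Prepared A p (2 * (numberedBags e bag).flatten.length)
      (edges.map fun x => ((e x.1 : ℕ), (e x.2 : ℕ))) (numberedBags e bag))
    (w y : Fin (2 * (numberedBags e bag).flatten.length)) :
    RAM.arrayKey A p (2 * (numberedBags e bag).flatten.length) 9 13 11 w y =
      listKey ((decompositionFrame e hbag hX).womanSection w) y := by
  have h1 : A 13 w = w := hA.self w w.2
  have h2 : A 9 w = ((decompositionFrame e hbag hX).σ.symm w : ℕ) := hA.symm w w.2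
  rw [RAM.arrayKey, listKey, RAM.arraySection, h1, h2, listSection_comp Fin.val_injective,
    RotationFrame.womanSection]
  congr 3
  · funext x
    exact hA.bg x x.2
  · funext x
    rw [hA.adj']
    exact propext (exists_edge_iff' hedge (own_eq hbag hX hA w) (own_eq hbag hX hA x))

end Correctness

/-! ### The main theorem -/

theorem mainTheorem6 :
    ∃ (c : RAM.Prog) (a t d : ℕ), ∀ (V : Type*) [PartialOrder V] [DecidableEq V]
      (p r k : ℕ) (e : V ≃ Fin p) (X : Fin r → Finset V)
      (edges : List (V × V)) (bag : Fin r → List V),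
      IsNicePathDecomposition (SimpleGraph.hasse V) X →
      pathDecompositionWidth X = k →
      edges.Nodup → (∀ u v : V, (u, v) ∈ edges ↔ u ⋖ v) →
      (∀ i, (bag i).Nodup ∧ (bag i).toFinset = X i) →
      ∃ (n : ℕ) (I : SMInstance n),
        I.InRange (9 * (k + 2)) ∧ I.Realizes V ∧ 2 * n ≤ a * (k + 1) * p ∧
        ∃ (s : RAM.State) (T : ℕ), T ≤ t * (k + 1) ^ 2 * p ^ 2 ∧
          RAM.Exec (d * p ^ d) c
            (RAM.inputState p
              (edges.map fun x => ((e x.1 : ℕ), (e x.2 : ℕ)))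
              (List.ofFn fun i => (bag i).map fun v => (e v : ℕ)))
            s T ∧
          s.Holds I := by
  -- With `W = (k+1)p` one has `N ≤ 3W`. The agents number `4N`, giving 12. In the step count the
  -- quadratic term `840 N²` contributes at most `7560 W²`, and the rest fits below 9000. Words must
  -- hold `(2N)² ≤ 36 p⁴`; as `d` is both factor and exponent, 40 is ample.
  refine ⟨RAM.mainCode, 12, 9000, 40, ?_⟩
  intro V _ _ p r k e X edges bag hX hk hnd hedge hbag
  have hfin : Finite V := Finite.of_equiv _ e.symm
  have : Fintype V := Fintype.ofFinite V
  have hcardV : Fintype.card V = p := by rw [Fintype.card_congr e, Fintype.card_fin]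
  set N := (numberedBags e bag).flatten.length with hN
  set R : RotationFrame V (2 * N) := decompositionFrame e hbag hX.1 with hR
  -- The width is a truncated difference; the one-element first bag ensures that nothing is lost.
  have hsup : (Finset.univ.sup fun i => (X i).card) = k + 1 := by
    have h1 := hX.2.2.1 ⟨0, hX.2.1⟩ rfl
    have h2 := Finset.le_sup (f := fun i => (X i).card) (Finset.mem_univ (⟨0, hX.2.1⟩ : Fin r))
    rw [← hk, pathDecompositionWidth]
    omega
  have hkX : ∀ i, (X i).card ≤ k + 1 := fun i => by
    rw [← hsup]
    exact Finset.le_sup (f := fun i => (X i).card) (Finset.mem_univ i)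
  -- A bag has at most `p` elements, so `W ≤ p²`: the word size may depend on `p` alone.
  have hkp : k + 1 ≤ p := by
    rw [← hsup, ← hcardV]
    exact Finset.sup_le fun i _ => Finset.card_le_univ _
  have hNpos : 0 < N := by
    have h1 := hX.2.2.1 ⟨0, hX.2.1⟩ rfl
    obtain ⟨v, hv⟩ := Finset.card_pos.1 (show 0 < (X ⟨0, hX.2.1⟩).card by omega)
    obtain ⟨q, hq, -⟩ := exists_bagWord e hbag hv
    exact (Nat.zero_le q).trans_lt hq
  have hr := hX.length_le
  rw [hcardV] at hr
  have hNle : N ≤ r * (k + 1) := flatten_length_le e hbag hkX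
  have hN3 : N ≤ 3 * ((k + 1) * p) := by
    calc N ≤ r * (k + 1) := hNle
      _ ≤ (3 * p) * (k + 1) := Nat.mul_le_mul_right _ (by omega)
      _ = 3 * ((k + 1) * p) := by ring
  have hE : edges.length ≤ p * p := by
    have := hnd.length_le_card
    rwa [Fintype.card_prod, hcardV] at this
  set W := (k + 1) * p with hW
  have hW1 : 1 ≤ W := Nat.mul_pos (by omega) (by omega)
  have hpW : p ≤ W := Nat.le_mul_of_pos_left p (by omega)
  have hWp : W ≤ p * p := Nat.mul_le_mul_right p hkp
  have hBig : 40 * (p * p * (p * p)) ≤ 40 * p ^ 40 := by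
    refine Nat.mul_le_mul_left 40 ?_
    rw [show p * p * (p * p) = p ^ 4 by ring]
    exact Nat.pow_le_pow_right (by omega) (by omega)
  have hp1 : p ≤ p * p := Nat.le_mul_self p
  have hp2 : p * p ≤ p * p * (p * p) := Nat.le_mul_self _
  have hrun := RAM.mainCode_runs (B := 40 * p ^ 40) (p := p) (K := k + 1)
    (E := edges.map fun x => ((e x.1 : ℕ), (e x.2 : ℕ))) (L := numberedBags e bag) ?_
    (fun q hq => bagWord_lt e hbag hq) ?_ (by omega) (by rw [List.length_map]; omega) (by omega)
    (by rw [length_numberedBags]; omega) ?_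
  rotate_left
  · intro x hx
    obtain ⟨y, -, rfl⟩ := List.mem_map.1 hx
    exact ⟨(e y.1).2, (e y.2).2⟩
  · intro l hl
    obtain ⟨i, rfl⟩ := (List.mem_ofFn' _ _).1 hl
    rw [List.length_map, ← List.toFinset_card_of_nodup (hbag i).1, (hbag i).2]
    exact hkX i
  · calc 2 * N * (2 * N) ≤ (6 * (p * p)) * (6 * (p * p)) := Nat.mul_le_mul (by omega) (by omega)
      _ = 36 * (p * p * (p * p)) := by ring
      _ ≤ _ := by omega
  obtain ⟨s, T, hT, hexec, hreg, A, hA, hman, hwoman⟩ := hrun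
  refine ⟨2 * N, R.toInstance, ⟨by omega, ?_⟩, R.realizes R.fits_toInstance, ?_, s, T, ?_, hexec,
    hreg, fun m j => ?_, fun w j => ?_⟩
  · have : Nonempty (Fin (2 * N)) := ⟨⟨0, by omega⟩⟩
    have := R.range_toInstance_le (c := 2 * (k + 1)) (card_bg_eq_le e hbag hX.1 hkX)
    omega
  · rw [mul_assoc, ← hW]; omega
  · refine hT.trans ?_
    rw [List.length_map, length_numberedBags]
    have h1 : edges.length ≤ W * W := hE.trans (Nat.mul_le_mul hpW hpW)
    have h2 : r * (k + 1) ≤ 3 * W :=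
      (Nat.mul_le_mul_right (k + 1) (show r ≤ 3 * p by omega)).trans_eq (by rw [hW]; ring)
    have h3 : N * N ≤ 9 * (W * W) := (Nat.mul_le_mul hN3 hN3).trans_eq (by ring)
    have h4 : W ≤ W * W := Nat.le_mul_self W
    calc _ = edges.length * 11 + 11 + 25 * (r * (k + 1)) + 5 * r + 840 * (N * N) + 136 * N + 10 := by
          ring
      _ ≤ 9000 * (W * W) := by omega
      _ = 9000 * (k + 1) ^ 2 * p ^ 2 := by rw [hW]; ring
  · obtain ⟨w, rfl⟩ := (R.toInstance.man m).symm.surjective j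
    rw [Equiv.apply_symm_apply, ← hman m m.2 w w.2,
      rankBelow_eq_rankEquiv (arrayKey_man hbag hX.1 hedge hA m)]
    rfl
  · obtain ⟨m, rfl⟩ := (R.toInstance.woman w).symm.surjective j
    rw [Equiv.apply_symm_apply, ← hwoman w w.2 m m.2,
      rankBelow_eq_rankEquiv (arrayKey_woman hbag hX.1 hedge hA w)]
    rfl
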